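/- Let $b,s\in\mathbb R$ with $b\neq 0$ and $27s-38b^2>0$, and let $\mathbb T=\mathbb R/2\pi\mathbb Z$. For $\varepsilon>0$ and $\omega\in(-\tfrac12,\tfrac12)$, a *roll* is a nontrivial even $2\pi$-periodic $C^4$ function $u=u(x)$, $u:\mathbb R\to\mathbb R$, with $$-\big(1+(1+2\varepsilon\omega)\partial_x^2\big)^2u+\varepsilon^2u+bu^2-su^3=0 .$$ For a roll $u$ and $\sigma=(\sigma_1,\sigma_2)\in\mathbb R^2$ let $$B(\varepsilon,\omega,\sigma)=-\big[1+(1+2\varepsilon\omega)(\partial_x+i\sigma_1)^2-\sigma_2^2\big]^2+\varepsilon^2+2bu-3su^2$$ be the Bloch operator, acting on $L^2(\mathbb T)$ with domain $H^4(\mathbb T)$. An *unstable eigenvalue* is a positive eigenvalue. There is $\rho_0>0$ such that for every $\rho\in(0,\rho_0]$ and every $\varepsilon_0>0$ there is $\bar\varepsilon_0\in(0,\varepsilon_0]$ with the following property. For all $\varepsilon\in(0,\bar\varepsilon_0]$ and all $\omega\in(-\tfrac12,\tfrac12)$ there is a roll $u$ with $\sup|u|\le\rho$, and for every such roll: 1.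 there are $\bar\sigma\in\mathbb R^2$ and $\lambda_M>0$ such that $\lambda_M$ is an eigenvalue of $B(\varepsilon,\omega,\bar\sigma)$, and $\mu\le\lambda_M$ for every $\sigma\in\mathbb R^2$ and every unstable eigenvalue $\mu$ of $B(\varepsilon,\omega,\sigma)$; 2. there are an open neighborhood $\mathcal N\subset\mathbb R^2$ of $\bar\sigma$ and a real-analytic function $\lambda:\mathcal N\to\mathbb R$ such that $\lambda(\bar\sigma)=\lambda_M$ and, for each $\sigma\in\mathcal N$, $\lambda(\sigma)$ is an unstable eigenvalue of $B(\varepsilon,\omega,\sigma)$. -/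

import Mathlib

open MeasureTheory Set Topology
open scoped ENNReal Real

/-- `2π > 0`, so that the circle `ℝ / 2πℤ` has Haar measure and Fourier series. -/
instance instFactTwoPiPosRoll : Fact (0 < 2 * π) := ⟨Real.two_pi_pos⟩

/-- The torus `𝕋 = ℝ / 2πℤ`. -/
abbrev Torus : Type := AddCircle (2 * π)

/-- The complex Hilbert space `L²(𝕋)` (with normalized Haar measure). -/
abbrev L2Torus : Type := Lp ℂ 2 (AddCircle.haarAddCircle (T := 2 * π))

/-- The `n`-th Fourier coefficient of `f ∈ L²(𝕋)`, with respect to `x ↦ exp (i n x)`. -/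
noncomputable def torusCoeff (f : L2Torus) (n : ℤ) : ℂ := fourierBasis.repr f n

/-- The Sobolev space `H⁴(𝕋)`: the `f ∈ L²(𝕋)` for which `((1 + n²)² f̂(n))` is in `ℓ²(ℤ)`. -/
noncomputable def sobolevH4 : Submodule ℂ L2Torus where
  carrier := {f | Memℓp (fun n : ℤ => ((1 + (n : ℝ) ^ 2) ^ 2 : ℝ) • torusCoeff f n) 2}
  add_mem' := by
    intro f g hf hg
    have h := Memℓp.add hf hg
    refine (congrArg (fun c : ℤ → ℂ => Memℓp c 2) ?_).mp h
    funext n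
    simp [torusCoeff]
  zero_mem' := by
    refine (congrArg (fun c : ℤ → ℂ => Memℓp c 2) ?_).mp
      (zero_memℓp (E := fun _ : ℤ => ℂ) (p := 2))
    funext n
    simp [torusCoeff]
  smul_mem' := by
    intro c f hf
    have h := Memℓp.const_smul hf c
    refine (congrArg (fun c : ℤ → ℂ => Memℓp c 2) ?_).mp h
    funext n
    simp [torusCoeff]
    ring

/-- The Fourier symbol of `-[1 + (1 + 2εω)(∂ₓ + iσ₁)² - σ₂²]²`, where `∂ₓ` has symbol `i n`. -/
noncomputable def blochSymbol (ε ω : ℝ) (σ : ℝ × ℝ) (n : ℤ) : ℂ :=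
  -(1 + (1 + 2 * (ε : ℂ) * ω) * (Complex.I * n + Complex.I * σ.1) ^ 2 - (σ.2 : ℂ) ^ 2) ^ 2

theorem norm_blochSymbol_le (ε ω : ℝ) (σ : ℝ × ℝ) : ∃ C : ℝ, ∀ n : ℤ,
    ‖blochSymbol ε ω σ n‖ ≤ C * (1 + (n : ℝ) ^ 2) ^ 2 := by
  refine ⟨(1 + 2 * |1 + 2 * ε * ω| * (1 + σ.1 ^ 2) + σ.2 ^ 2) ^ 2, fun n => ?_⟩
  have h1 : blochSymbol ε ω σ n
      = ((-(1 - (1 + 2 * ε * ω) * (n + σ.1) ^ 2 - σ.2 ^ 2) ^ 2 : ℝ) : ℂ) := by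
    have h : (Complex.I * n + Complex.I * σ.1) ^ 2 = -((n : ℂ) + σ.1) ^ 2 := by
      rw [← mul_add, mul_pow, Complex.I_sq]; ring
    rw [blochSymbol, h]
    push_cast
    ring
  rw [h1, Complex.norm_real, Real.norm_eq_abs, abs_neg, abs_pow, ← mul_pow]
  refine pow_le_pow_left₀ (abs_nonneg _) ?_ 2
  have h2 : |(1 + 2 * ε * ω) * (n + σ.1) ^ 2|
      ≤ |1 + 2 * ε * ω| * (2 * ((1 + σ.1 ^ 2) * (1 + (n : ℝ) ^ 2))) := by
    rw [abs_mul, abs_of_nonneg (sq_nonneg ((n : ℝ) + σ.1))]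
    refine mul_le_mul_of_nonneg_left ?_ (abs_nonneg _)
    nlinarith [sq_nonneg ((n : ℝ) - σ.1), sq_nonneg ((n : ℝ) * σ.1)]
  have h3 := abs_le.mp h2
  have h4 : 0 ≤ σ.2 ^ 2 * (n : ℝ) ^ 2 := by positivity
  have h5 : 0 ≤ (n : ℝ) ^ 2 := by positivity
  have h6 : 0 ≤ σ.2 ^ 2 := by positivity
  rw [abs_le]
  constructor <;> nlinarith [h3.1, h3.2]

theorem memℓp_blochSymbol (ε ω : ℝ) (σ : ℝ × ℝ) (f : sobolevH4) :
    Memℓp (fun n : ℤ => blochSymbol ε ω σ n * torusCoeff f n) 2 := by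
  obtain ⟨C, hC⟩ := norm_blochSymbol_le ε ω σ
  have hf : Memℓp (fun n : ℤ => ((1 + (n : ℝ) ^ 2) ^ 2 : ℝ) • torusCoeff (f : L2Torus) n) 2 := f.2
  refine (Memℓp.const_smul hf C).mono' (fun n => ?_)
  have h0 : 0 ≤ (1 + (n : ℝ) ^ 2) ^ 2 := by positivity
  have hC' : 0 ≤ C := by simpa using (norm_nonneg _).trans (hC 0)
  rw [Pi.smul_apply, norm_mul, norm_smul, norm_smul, Real.norm_of_nonneg h0,
    Real.norm_of_nonneg hC', ← mul_assoc]
  exact mul_le_mul_of_nonneg_right (hC n) (norm_nonneg _)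

/-- The constant coefficient operator `-[1 + (1 + 2εω)(∂ₓ + iσ₁)² - σ₂²]²` from `H⁴(𝕋)` to
`L²(𝕋)`. -/
noncomputable def blochPrincipal (ε ω : ℝ) (σ : ℝ × ℝ) : sobolevH4 →ₗ[ℂ] L2Torus where
  toFun f := fourierBasis.repr.symm
    ⟨fun n : ℤ => blochSymbol ε ω σ n * torusCoeff f n, memℓp_blochSymbol ε ω σ f⟩
  map_add' f g := by
    rw [← map_add]
    congr 1
    ext n
    refine (congrArg (blochSymbol ε ω σ n * ·) ?_).trans (mul_add _ _ _)
    simp [torusCoeff]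
  map_smul' c f := by
    rw [RingHom.id_apply, ← map_smul]
    congr 1
    ext n
    simp [torusCoeff]
    ring

/-- The potential `ε² + 2bu - 3su²`, a continuous function on `𝕋`. -/
noncomputable def rollPotential (b s ε : ℝ) (u : C(Torus, ℝ)) : C(Torus, ℂ) :=
  ⟨fun x => ((ε ^ 2 + 2 * b * u x - 3 * s * u x ^ 2 : ℝ) : ℂ), by fun_prop⟩

/-- Multiplication by a continuous function on `L²(𝕋)`. -/
noncomputable def mulL2 (φ : C(Torus, ℂ)) : L2Torus →ₗ[ℂ] L2Torus where
  toFun f := (ContinuousMap.toLp ∞ AddCircle.haarAddCircle ℂ φ : Lp ℂ ∞ _) • f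
  map_add' f g := Lp.add_smul _ f g
  map_smul' c f := (Lp.smul_comm c _ f).symm

/-- The Bloch operator
`B(ε, ω, σ) = -[1 + (1 + 2εω)(∂ₓ + iσ₁)² - σ₂²]² + ε² + 2bu - 3su²`
linearized about the profile `u`, as an unbounded operator on `L²(𝕋)` with domain `H⁴(𝕋)`. -/
noncomputable def blochOperator (b s ε ω : ℝ) (u : C(Torus, ℝ)) (σ : ℝ × ℝ) :
    L2Torus →ₗ.[ℂ] L2Torus where
  domain := sobolevH4
  toFun := blochPrincipal ε ω σ + mulL2 (rollPotential b s ε u) ∘ₗ sobolevH4.subtype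

/-- `μ` is an unstable eigenvalue of the unbounded operator `A`: it is positive, and
`A W = μ W` for a nonzero `W` in the domain of `A`. -/
def IsUnstableEigenvalue (A : L2Torus →ₗ.[ℂ] L2Torus) (μ : ℝ) : Prop :=
  0 < μ ∧ ∃ W : A.domain, (W : L2Torus) ≠ 0 ∧ A W = (μ : ℂ) • (W : L2Torus)

/-- The differential operator `w ↦ w + κ w''` on functions of one real variable. -/
noncomputable def helmholtzOp (κ : ℝ) (w : ℝ → ℝ) : ℝ → ℝ :=
  fun x => w x + κ * iteratedDeriv 2 w x

/-- A roll: a nontrivial, even, `2π`-periodic, classical (`C⁴`) solution `u = u(x)` of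
`-(1 + (1 + 2εω) ∂ₓ²)² u + ε² u + b u² - s u³ = 0`. Periodicity is built in, as `u` is a
function on `ℝ / 2πℤ`. -/
structure IsRoll (b s ε ω : ℝ) (u : C(Torus, ℝ)) : Prop where
  contDiff : ContDiff ℝ 4 (fun x : ℝ => u (x : Torus))
  even : ∀ x : ℝ, u ((-x : ℝ) : Torus) = u (x : Torus)
  nontrivial : u ≠ 0
  stationary : ∀ x : ℝ,
    -helmholtzOp (1 + 2 * ε * ω) (helmholtzOp (1 + 2 * ε * ω) (fun y : ℝ => u (y : Torus))) x
      + ε ^ 2 * u (x : Torus) + b * u (x : Torus) ^ 2 - s * u (x : Torus) ^ 3 = 0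

/-! With `κ = 1 + 2εω`, the Bloch operator acts on Fourier coefficients as `V - diag (dispersion κ σ
n ^ 2)`, where `V` is multiplication by `ε² + 2bu - 3su²`. Every small roll is `u = 2a cos x +
O(a²)` with `a ≠ 0`, so `V` is `ε²` plus the next-neighbour coupling of strength `t = 2ab`, up to
`O(t²)`. Two facts about this structure give the instability.

At `σ₁ = 1/2` the neighbouring modes `0` and `-1` can be made exactly resonant by the choice of
`σ₂`, and their coupling produces a growth rate of at least `ε² + |t| - O(t²)`
(`exists_resonant_test`). On the other hand, for every `σ` at most two modes are nearly resonant
(`exists_two_modes`), and on a suitable subspace of codimension one the quadratic form is at most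
`ε² + O(t²)` (`form_le_of_two_modes`). For small `t` the top of the spectrum is therefore a simple
eigenvalue with a gap below it. It is attained in `σ` by compactness (`exists_maximizer`), because
large `σ₂` is stable and `σ₁` matters only modulo `1` (`coeff_eigen_shift`). It continues
analytically in `σ` by the implicit function theorem for a bordered operator
(`exists_analytic_eigenvalue`).

Only `a ≠ 0` and the smallness of `a` enter there, so no asymptotics of `a` in `ε` are needed and
the conclusion covers every small roll (`IsRoll.bounds`). The sign of `27s - 38b²` is used only for
existence (`exists_roll`): a Lyapunov–Schmidt reduction to the modes `±1` leaves the scalar equation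
`ε²(1 - 4ω²) a - (27s - 38b²) a³ / 9 + ... = 0`, which has a positive root by the intermediate value
theorem.

Unboundedness is avoided throughout by writing coefficients as `c = W g` with `W = diag (1 / (1 +
n²))`: the operator `W (μ - B) W` is bounded and polynomial in `(σ, μ)`. -/

/-! ### Weighted diagonal operators on the Fourier coefficients. -/

/-- The Hilbert space `ℓ²(ℤ)` of Fourier coefficients. -/
abbrev SeqSpace : Type := lp (fun _ : ℤ => ℂ) 2

theorem hasSum_norm_sq_seq (g : SeqSpace) : HasSum (fun n => ‖g n‖ ^ 2) (‖g‖ ^ 2) := by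
  have h := lp.hasSum_norm (p := 2) (by simp) g
  simpa using h

theorem norm_sq_le_of_forall_le {f g h : SeqSpace} {A B : ℝ}
    (H : ∀ n, ‖f n‖ ^ 2 ≤ A * ‖g n‖ ^ 2 + B * ‖h n‖ ^ 2) :
    ‖f‖ ^ 2 ≤ A * ‖g‖ ^ 2 + B * ‖h‖ ^ 2 :=
  hasSum_le H (hasSum_norm_sq_seq f)
    (((hasSum_norm_sq_seq g).mul_left A).add ((hasSum_norm_sq_seq h).mul_left B))

/-- The diagonal operator on `ℓ²(ℤ)` with real entries `d n`, bounded by `C`. -/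
noncomputable def diagOp (d : ℤ → ℝ) (C : ℝ) (hd : ∀ n, |d n| ≤ C) : SeqSpace →L[ℂ] SeqSpace :=
  LinearMap.mkContinuous
    { toFun := fun g => ⟨fun n => (d n : ℂ) * g n, by
        refine (Memℓp.const_smul (lp.memℓp g) C).mono' fun n => ?_
        rw [norm_mul, Pi.smul_apply, norm_smul, Complex.norm_real, Real.norm_eq_abs]
        exact mul_le_mul_of_nonneg_right ((hd n).trans (le_abs_self C)) (norm_nonneg _)⟩
      map_add' := fun f g => by ext n; exact mul_add _ _ _
      map_smul' := fun c f => by ext n; simp; ring } C (fun g => by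
        have hC : 0 ≤ C := (abs_nonneg _).trans (hd 0)
        refine le_of_sq_le_sq ?_ (by positivity)
        refine (norm_sq_le_of_forall_le (g := g) (h := 0) (A := C ^ 2) (B := 0) fun n => ?_).trans
          (by simp [mul_pow])
        have := hd n
        simp only [LinearMap.coe_mk, AddHom.coe_mk, norm_mul, Complex.norm_real, Real.norm_eq_abs,
          mul_pow, zero_mul, add_zero]
        gcongr)

@[simp] theorem diagOp_apply (d : ℤ → ℝ) (C : ℝ) (hd : ∀ n, |d n| ≤ C) (g : SeqSpace) (n : ℤ) :
    diagOp d C hd g n = (d n : ℂ) * g n := rfl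

theorem inner_diagOp_left (d : ℤ → ℝ) (C : ℝ) (hd : ∀ n, |d n| ≤ C) (f g : SeqSpace) :
    inner ℂ (diagOp d C hd f) g = inner ℂ f (diagOp d C hd g) := by
  rw [lp.inner_eq_tsum, lp.inner_eq_tsum]
  congr 1
  funext n
  simp [mul_assoc, mul_left_comm]

/-- The weight operator `diag (1 / (1 + n²))`. -/
noncomputable def weightOp : SeqSpace →L[ℂ] SeqSpace :=
  diagOp (fun n => (1 + (n : ℝ) ^ 2)⁻¹) 1 fun n => by
    have : (0 : ℝ) ≤ (n : ℝ) ^ 2 := sq_nonneg _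
    rw [abs_of_nonneg (by positivity)]
    exact inv_le_one_of_one_le₀ (by linarith)

/-- The operator `diag (n / (1 + n²))`. -/
noncomputable def firstOrderOp : SeqSpace →L[ℂ] SeqSpace :=
  diagOp (fun n => n * (1 + (n : ℝ) ^ 2)⁻¹) 1 fun n => by
    have : (0 : ℝ) ≤ (n : ℝ) ^ 2 := sq_nonneg _
    rw [← div_eq_mul_inv, abs_div, abs_of_nonneg (by positivity : (0:ℝ) ≤ 1 + (n : ℝ) ^ 2),
      div_le_one (by positivity)]
    nlinarith [sq_abs (n : ℝ), abs_nonneg (n : ℝ), sq_nonneg (|(n : ℝ)| - 1)]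

/-- The dispersion relation `1 - κ (n + σ₁)² - σ₂²`. -/
def dispersion (κ : ℝ) (σ : ℝ × ℝ) (n : ℤ) : ℝ := 1 - κ * (n + σ.1) ^ 2 - σ.2 ^ 2

/-- The operator `diag ((1 - κ (n + σ₁)² - σ₂²) / (1 + n²))`, written as a polynomial in `σ`. -/
noncomputable def dispersionOp (κ : ℝ) (σ : ℝ × ℝ) : SeqSpace →L[ℂ] SeqSpace :=
  (1 - κ * σ.1 ^ 2 - σ.2 ^ 2) • weightOp - (2 * κ * σ.1) • firstOrderOp - κ • (1 - weightOp)

theorem one_add_sq_pos (n : ℤ) : (0 : ℝ) < 1 + (n : ℝ) ^ 2 := by positivity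

@[simp] theorem weightOp_apply (g : SeqSpace) (n : ℤ) :
    weightOp g n = ((1 + (n : ℝ) ^ 2)⁻¹ : ℝ) * g n := rfl

@[simp] theorem dispersionOp_apply (κ : ℝ) (σ : ℝ × ℝ) (g : SeqSpace) (n : ℤ) :
    dispersionOp κ σ g n = (dispersion κ σ n : ℂ) * weightOp g n := by
  have h : (1 + (n : ℂ) ^ 2) ≠ 0 := by exact_mod_cast (one_add_sq_pos n).ne'
  change ((1 - κ * σ.1 ^ 2 - σ.2 ^ 2 : ℝ) • weightOp g n
    - (2 * κ * σ.1 : ℝ) • (((n * (1 + (n : ℝ) ^ 2)⁻¹ : ℝ) : ℂ) * g n)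
    - κ • (g n - weightOp g n) : ℂ) = _
  simp only [dispersion, weightOp_apply, Complex.real_smul]
  push_cast
  field_simp
  ring

theorem inner_weightOp_left (f g : SeqSpace) :
    inner ℂ (weightOp f) g = inner ℂ f (weightOp g) := inner_diagOp_left _ _ _ f g

theorem inner_dispersionOp_left (κ : ℝ) (σ : ℝ × ℝ) (f g : SeqSpace) :
    inner ℂ (dispersionOp κ σ f) g = inner ℂ f (dispersionOp κ σ g) := by
  rw [lp.inner_eq_tsum, lp.inner_eq_tsum]
  congr 1
  funext n
  simp [mul_assoc, mul_left_comm]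

theorem weightOp_injective : Function.Injective weightOp := by
  intro f g h
  ext n
  have h1 := congrArg (fun x : SeqSpace => x n) h
  have h2 : (1 + (n : ℂ) ^ 2) ≠ 0 := by exact_mod_cast (one_add_sq_pos n).ne'
  simpa [h2] using h1

/-- Ellipticity of the symbol: `κ (n + σ₁)²` is at most `1 + |dispersion|` because `σ₂²` has the
favourable sign, and `n² ≤ 2 (n + σ₁)² + 2 σ₁²`. The bound does not involve `σ₂`, which is not yet
known to be bounded where this is used. -/
theorem one_add_sq_le_dispersion {κ : ℝ} (hκ : 3 / 4 ≤ κ) (σ : ℝ × ℝ) (n : ℤ) :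
    1 + (n : ℝ) ^ 2 ≤ (4 + 2 * σ.1 ^ 2) * (1 + |dispersion κ σ n|) := by
  have h1 : κ * ((n : ℝ) + σ.1) ^ 2 ≤ 1 + |dispersion κ σ n| := by
    have := neg_abs_le (dispersion κ σ n)
    simp only [dispersion] at this ⊢
    nlinarith [sq_nonneg σ.2]
  have h2 : 0 ≤ |dispersion κ σ n| := abs_nonneg _
  have h3 : (3 / 4) * ((n : ℝ) + σ.1) ^ 2 ≤ κ * ((n : ℝ) + σ.1) ^ 2 :=
    mul_le_mul_of_nonneg_right hκ (sq_nonneg _)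
  nlinarith [sq_nonneg ((n : ℝ) + 2 * σ.1), mul_nonneg (sq_nonneg σ.1) h2]

/-- Coercivity of the principal part: `Y(σ)` and the weight control the norm. -/
theorem norm_sq_le_dispersionOp {κ : ℝ} (hκ : 3 / 4 ≤ κ) (σ : ℝ × ℝ) (g : SeqSpace) :
    ‖g‖ ^ 2 ≤ 2 * (4 + 2 * σ.1 ^ 2) ^ 2 * (‖weightOp g‖ ^ 2 + ‖dispersionOp κ σ g‖ ^ 2) := by
  rw [mul_add]
  refine norm_sq_le_of_forall_le fun n => ?_
  have h0 := one_add_sq_pos n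
  have h1 := one_add_sq_le_dispersion hκ σ n
  have h2 : ‖g n‖ = (1 + (n : ℝ) ^ 2) * ‖weightOp g n‖ := by
    rw [weightOp_apply, norm_mul, Complex.norm_real, Real.norm_of_nonneg (by positivity),
      mul_inv_cancel_left₀ h0.ne']
  have h3 : ‖g n‖ ≤ (4 + 2 * σ.1 ^ 2) * (‖weightOp g n‖ + ‖dispersionOp κ σ g n‖) := by
    rw [h2, dispersionOp_apply, norm_mul, Complex.norm_real, Real.norm_eq_abs]
    nlinarith [mul_le_mul_of_nonneg_right h1 (norm_nonneg (weightOp g n))]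
  calc ‖g n‖ ^ 2 ≤ ((4 + 2 * σ.1 ^ 2) * (‖weightOp g n‖ + ‖dispersionOp κ σ g n‖)) ^ 2 := by gcongr
    _ ≤ _ := by
      rw [mul_pow]
      nlinarith [mul_nonneg (sq_nonneg (4 + 2 * σ.1 ^ 2))
        (sq_nonneg (‖weightOp g n‖ - ‖dispersionOp κ σ g n‖))]

theorem summable_inv_one_add_sq : Summable fun n : ℤ => (1 + (n : ℝ) ^ 2)⁻¹ := by
  have h : Summable fun n : ℤ => 1 / (n : ℝ) ^ 2 :=
    Real.summable_one_div_int_pow.mpr one_lt_two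
  refine Summable.of_norm_bounded_eventually (g := fun n : ℤ => 1 / (n : ℝ) ^ 2) h ?_
  filter_upwards [(Set.finite_singleton (0 : ℤ)).compl_mem_cofinite] with n hn
  have hn' : (n : ℝ) ≠ 0 := by exact_mod_cast hn
  rw [Real.norm_of_nonneg (inv_nonneg.mpr (one_add_sq_pos n).le), one_div]
  gcongr
  linarith

theorem inv_one_add_sq_le_one (n : ℤ) : (1 + (n : ℝ) ^ 2)⁻¹ ≤ 1 :=
  inv_le_one_of_one_le₀ (by nlinarith [sq_nonneg (n : ℝ)])

theorem summable_inv_one_add_sq_sq : Summable fun n : ℤ => ((1 + (n : ℝ) ^ 2)⁻¹) ^ 2 := by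
  refine summable_inv_one_add_sq.of_nonneg_of_le (fun n => by positivity) fun n => ?_
  have := inv_one_add_sq_le_one n
  have h0 := inv_pos.mpr (one_add_sq_pos n)
  nlinarith

/-- The weight operator turns bounded pointwise convergence into norm convergence. -/
theorem tendsto_weightOp_of_pointwise {g : ℕ → SeqSpace} {g₀ : SeqSpace} {R : ℝ}
    (hR : ∀ j, ‖g j‖ ≤ R) (h : ∀ n, Filter.Tendsto (fun j => g j n) Filter.atTop (𝓝 (g₀ n))) :
    Filter.Tendsto (fun j => weightOp (g j)) Filter.atTop (𝓝 (weightOp g₀)) := by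
  rw [tendsto_iff_norm_sub_tendsto_zero]
  have hb : ∀ j n, ‖g j n‖ ≤ R := fun j n => (lp.norm_apply_le_norm (by simp) _ n).trans (hR j)
  have hb0 : ∀ n, ‖g₀ n‖ ≤ R := fun n => le_of_tendsto' (h n).norm fun j => hb j n
  have key : Filter.Tendsto (fun j => ∑' n, ‖weightOp (g j - g₀) n‖ ^ 2) Filter.atTop
      (𝓝 (∑' _ : ℤ, (0 : ℝ))) := by
    refine tendsto_tsum_of_dominated_convergence
      (summable_inv_one_add_sq_sq.mul_right ((2 * R) ^ 2)) (fun n => ?_) (.of_forall fun j n => ?_)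
    · have h1 : Filter.Tendsto (fun j => weightOp (g j - g₀) n) Filter.atTop (𝓝 0) := by
        have := (((h n).sub_const (g₀ n)).const_mul (((1 + (n : ℝ) ^ 2)⁻¹ : ℝ) : ℂ))
        simpa [mul_sub] using this
      simpa [mul_sub] using h1.norm.pow 2
    · rw [Real.norm_of_nonneg (by positivity), weightOp_apply, norm_mul, mul_pow,
        Complex.norm_real, Real.norm_of_nonneg (by have := one_add_sq_pos n; positivity)]
      gcongr
      calc ‖(g j - g₀) n‖ ≤ ‖g j n‖ + ‖g₀ n‖ := by simpa using norm_sub_le (g j n) (g₀ n)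
        _ ≤ 2 * R := by linarith [hb j n, hb0 n]
  simp only [tsum_zero, (hasSum_norm_sq_seq _).tsum_eq] at key
  have := key.sqrt
  simpa [Real.sqrt_sq] using this

/-! ### The bounded pencil and the maximizer of its quadratic form. -/

/-- The operator `W (μ - B(σ)) W`, where `W` is the weight and `B(σ) = V - diag (disp²)`. -/
noncomputable def pencil (κ : ℝ) (V : SeqSpace →L[ℂ] SeqSpace) (p : (ℝ × ℝ) × ℝ) :
    SeqSpace →L[ℂ] SeqSpace :=
  p.2 • (weightOp * weightOp) + dispersionOp κ p.1 * dispersionOp κ p.1 - weightOp * V * weightOp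

theorem pencil_apply (κ : ℝ) (V : SeqSpace →L[ℂ] SeqSpace) (p : (ℝ × ℝ) × ℝ) (g : SeqSpace) :
    pencil κ V p g = (p.2 : ℂ) • weightOp (weightOp g) + dispersionOp κ p.1 (dispersionOp κ p.1 g)
      - weightOp (V (weightOp g)) := rfl

section Pencil

variable {κ : ℝ} {V : SeqSpace →L[ℂ] SeqSpace}

theorem inner_self_eq_ofReal_norm_sq (x : SeqSpace) : inner ℂ x x = ((‖x‖ ^ 2 : ℝ) : ℂ) := by
  rw [inner_self_eq_norm_sq_to_K]
  norm_cast

theorem inner_pencil_left (hV : ∀ f g, inner ℂ (V f) g = inner ℂ f (V g)) (p : (ℝ × ℝ) × ℝ)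
    (f g : SeqSpace) : inner ℂ (pencil κ V p f) g = inner ℂ f (pencil κ V p g) := by
  simp only [pencil_apply, inner_add_left, inner_sub_left, inner_add_right, inner_sub_right,
    inner_weightOp_left, inner_dispersionOp_left, hV, inner_smul_left,
    inner_smul_right, Complex.conj_ofReal]

/-- With `c = W g` the right side is `μ ‖c‖² - ⟨B(σ) c, c⟩`. Nonnegativity of the pencil thus says
that `μ` bounds the quadratic form of `B(σ)`. -/
theorem re_inner_pencil (p : (ℝ × ℝ) × ℝ) (g : SeqSpace) :
    (inner ℂ (pencil κ V p g) g).re = p.2 * ‖weightOp g‖ ^ 2 + ‖dispersionOp κ p.1 g‖ ^ 2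
      - (inner ℂ (V (weightOp g)) (weightOp g)).re := by
  simp only [pencil_apply, inner_add_left, inner_sub_left,
    inner_weightOp_left, inner_dispersionOp_left, inner_smul_left,
    Complex.conj_ofReal, inner_self_eq_ofReal_norm_sq, Complex.add_re, Complex.sub_re,
    Complex.re_ofReal_mul, Complex.ofReal_re]

theorem re_inner_le_opNorm (V : SeqSpace →L[ℂ] SeqSpace) (c : SeqSpace) :
    (inner ℂ (V c) c).re ≤ ‖V‖ * ‖c‖ ^ 2 := by
  calc (inner ℂ (V c) c).re ≤ ‖V c‖ * ‖c‖ := re_inner_le_norm (𝕜 := ℂ) _ _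
    _ ≤ ‖V‖ * ‖c‖ * ‖c‖ := by gcongr; exact V.le_opNorm c
    _ = _ := by ring

/-- A nonnegative symmetric form vanishes at `g` only if the operator does. -/
theorem eq_zero_of_forall_re_inner_nonneg {A : SeqSpace →L[ℂ] SeqSpace}
    (hA : ∀ f g, inner ℂ (A f) g = inner ℂ f (A g)) (hpos : ∀ f, 0 ≤ (inner ℂ (A f) f).re)
    {g : SeqSpace} (hg : (inner ℂ (A g) g).re = 0) : A g = 0 := by
  by_contra h
  have hr : 0 < ‖A g‖ := norm_pos_iff.mpr h
  set r := A g with hrdef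
  -- Test the form at `g - s A g`: its value is `-2s ‖A g‖² + s² ⟨A r, r⟩`, which is negative as
  -- soon as `s ‖A‖ < 1`.
  set s : ℝ := (‖A‖ + 1)⁻¹ with hs
  have hs0 : 0 < s := by positivity
  have hs1 : s * ‖A‖ < 1 := by
    rw [hs, inv_mul_lt_iff₀ (by positivity)]; linarith
  have h1 := hpos (g - (s : ℂ) • r)
  have h2 : (inner ℂ (A (g - (s : ℂ) • r)) (g - (s : ℂ) • r)).re
      = -2 * s * ‖r‖ ^ 2 + s ^ 2 * (inner ℂ (A r) r).re := by
    have e1 : inner ℂ (A r) g = ((‖r‖ : ℂ)) ^ 2 := by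
      rw [hA, ← hrdef, inner_self_eq_norm_sq_to_K]; rfl
    have e2 : inner ℂ r r = ((‖r‖ : ℂ)) ^ 2 := by
      rw [inner_self_eq_norm_sq_to_K]; rfl
    simp only [map_sub, map_smul, inner_sub_left, inner_sub_right, inner_smul_left,
      inner_smul_right, Complex.conj_ofReal, e1, e2, ← hrdef]
    rw [← Complex.ofReal_pow]
    simp only [Complex.sub_re, Complex.re_ofReal_mul, Complex.ofReal_re, hg]
    ring
  have h3 := re_inner_le_opNorm A r
  have h4 : s * (inner ℂ (A r) r).re ≤ ‖r‖ ^ 2 := by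
    nlinarith [mul_le_mul_of_nonneg_left h3 hs0.le, sq_nonneg ‖r‖]
  have h5 : 0 < ‖r‖ ^ 2 := by positivity
  nlinarith

/-- The quadratic form of the Bloch operators attains its maximum over `σ₁ ∈ [0, 1]`. -/
theorem exists_maximizer (hκ : 3 / 4 ≤ κ) (hV : ∀ f g, inner ℂ (V f) g = inner ℂ f (V g))
    {θ : ℝ} (hθ : 0 < θ)
    (hpos : ∃ σ : ℝ × ℝ, σ.1 ∈ Icc (0 : ℝ) 1 ∧ ∃ g : SeqSpace, weightOp g ≠ 0 ∧
      θ * ‖weightOp g‖ ^ 2 ≤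
        (inner ℂ (V (weightOp g)) (weightOp g)).re - ‖dispersionOp κ σ g‖ ^ 2) :
    ∃ (lam : ℝ) (σ : ℝ × ℝ) (g : SeqSpace), θ ≤ lam ∧ ‖weightOp g‖ = 1 ∧
      pencil κ V (σ, lam) g = 0 ∧
      ∀ τ : ℝ × ℝ, τ.1 ∈ Icc (0 : ℝ) 1 → ∀ f, 0 ≤ (inner ℂ (pencil κ V (τ, lam) f) f).re := by
  set F : (ℝ × ℝ) → SeqSpace → ℝ := fun σ g =>
    (inner ℂ (V (weightOp g)) (weightOp g)).re - ‖dispersionOp κ σ g‖ ^ 2 with hF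
  have hscale : ∀ σ g, weightOp g ≠ 0 → ∃ f, ‖weightOp f‖ = 1 ∧
      F σ g = F σ f * ‖weightOp g‖ ^ 2 := by
    intro σ g hg
    have hg' : ‖weightOp g‖ ≠ 0 := norm_ne_zero_iff.mpr hg
    refine ⟨((‖weightOp g‖⁻¹ : ℝ) : ℂ) • g, ?_, ?_⟩
    · rw [map_smul, norm_smul, Complex.norm_real, norm_inv, norm_norm, inv_mul_cancel₀ hg']
    · simp only [hF, map_smul, inner_smul_left, inner_smul_right, Complex.conj_ofReal, norm_smul,
        Complex.norm_real, norm_inv, norm_norm, Complex.re_ofReal_mul]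
      field_simp
  set S : Set ℝ := {x | ∃ σ : ℝ × ℝ, σ.1 ∈ Icc (0 : ℝ) 1 ∧ ∃ g, ‖weightOp g‖ = 1 ∧ F σ g = x}
  have hFV : ∀ σ g, F σ g ≤ ‖V‖ * ‖weightOp g‖ ^ 2 - ‖dispersionOp κ σ g‖ ^ 2 := fun σ g =>
    sub_le_sub_right (re_inner_le_opNorm V _) _
  have hbdd : BddAbove S := by
    refine ⟨‖V‖, ?_⟩
    rintro x ⟨σ, -, g, hg, rfl⟩
    have := hFV σ g
    rw [hg] at this
    nlinarith [sq_nonneg ‖dispersionOp κ σ g‖]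
  obtain ⟨σ₁, hσ₁, g₁, hg₁, hθ₁⟩ := hpos
  obtain ⟨f₁, hf₁, hFf₁⟩ := hscale σ₁ g₁ hg₁
  have hmem₁ : F σ₁ f₁ ∈ S := ⟨σ₁, hσ₁, f₁, hf₁, rfl⟩
  have hθ₂ : θ ≤ F σ₁ f₁ := by
    have h1 : 0 < ‖weightOp g₁‖ ^ 2 := pow_pos (norm_pos_iff.mpr hg₁) 2
    refine le_of_mul_le_mul_right ?_ h1
    rw [← hFf₁]
    exact hθ₁
  have hθS : θ ≤ sSup S := hθ₂.trans (le_csSup hbdd hmem₁)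
  obtain ⟨x, -, hxS, hxmem⟩ := exists_seq_tendsto_sSup ⟨_, hmem₁⟩ hbdd
  -- The supremum is at least `θ > 0`, so a tail of the maximizing sequence has `F > 0`. Positivity
  -- of `F` is what bounds the dispersion term, and with it `g` and `σ₂`.
  obtain ⟨N, hN⟩ := Filter.eventually_atTop.mp (hxS.eventually_const_lt (hθ.trans_le hθS))
  replace hxmem : ∀ j, ∃ σ : ℝ × ℝ, σ.1 ∈ Icc (0 : ℝ) 1 ∧ ∃ g, ‖weightOp g‖ = 1 ∧
      F σ g = x (j + N) := fun j => hxmem (j + N)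
  choose σ hσ g hg hFg using hxmem
  have hxS' : Filter.Tendsto (fun j => F (σ j) (g j)) Filter.atTop (𝓝 (sSup S)) := by
    simp only [hFg]
    exact hxS.comp (Filter.tendsto_add_atTop_nat N)
  have hY : ∀ j, ‖dispersionOp κ (σ j) (g j)‖ ^ 2 ≤ ‖V‖ := fun j => by
    have h1 := hFV (σ j) (g j)
    have h2 := hN (j + N) (Nat.le_add_left N j)
    rw [← hFg, ] at h2
    rw [hg] at h1
    linarith
  have hgb : ∀ j, ‖g j‖ ≤ 72 * (1 + ‖V‖) := fun j => by
    have h1 := norm_sq_le_dispersionOp hκ (σ j) (g j)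
    have h2 : (4 + 2 * (σ j).1 ^ 2) ^ 2 ≤ 36 := by
      have h3 : (σ j).1 ^ 2 ≤ 1 := by nlinarith [(hσ j).1, (hσ j).2]
      nlinarith [sq_nonneg (σ j).1]
    have h3 := hY j
    rw [hg] at h1
    have h4 : ‖g j‖ ^ 2 ≤ 72 * (1 + ‖V‖) := h1.trans (by gcongr <;> linarith)
    have h5 : 0 ≤ ‖V‖ := norm_nonneg V
    nlinarith [norm_nonneg (g j)]
  -- For large `|σ₂|` every dispersion value is at most `1 - σ₂² ≤ -(1 + ‖V‖)`, which would force `F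
  -- < 0`.
  have hσ₂ : ∀ j, |(σ j).2| ≤ 2 + ‖V‖ := fun j => by
    by_contra hlt
    push Not at hlt
    have hV0 : 0 ≤ ‖V‖ := norm_nonneg V
    have h1 : (2 + ‖V‖) ^ 2 ≤ (σ j).2 ^ 2 := by
      rw [← sq_abs (σ j).2]; gcongr
    have h2 : (1 + ‖V‖) * ‖weightOp (g j)‖ ^ 2 ≤ ‖dispersionOp κ (σ j) (g j)‖ ^ 2 := by
      have := norm_sq_le_of_forall_le (f := weightOp (g j)) (g := dispersionOp κ (σ j) (g j))
        (h := 0) (A := (1 + ‖V‖)⁻¹) (B := 0) fun n => ?_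
      · rw [zero_mul, add_zero, ← div_eq_inv_mul, le_div_iff₀ (by positivity)] at this
        linarith
      · rw [zero_mul, add_zero, ← div_eq_inv_mul, le_div_iff₀ (by positivity), mul_comm,
          dispersionOp_apply, norm_mul, mul_pow]
        refine mul_le_mul_of_nonneg_right ?_ (sq_nonneg _)
        rw [Complex.norm_real, Real.norm_eq_abs, sq_abs]
        have h3 : 1 + ‖V‖ ≤ -dispersion κ (σ j) n := by
          simp only [dispersion]
          nlinarith [mul_nonneg (by linarith : (0 : ℝ) ≤ κ) (sq_nonneg ((n : ℝ) + (σ j).1))]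
        nlinarith
    rw [hg] at h2
    linarith [hY j]
  -- Tychonoff gives a subsequence converging mode by mode; `W` upgrades this to norm convergence of
  -- `W g`, so weak compactness of the ball is not needed.
  have hK : IsCompact ((univ.pi fun _ : ℤ => Metric.closedBall (0 : ℂ) (72 * (1 + ‖V‖))) ×ˢ
      (Icc (0 : ℝ) 1 ×ˢ Icc (-(2 + ‖V‖)) (2 + ‖V‖))) :=
    (isCompact_univ_pi fun _ => isCompact_closedBall _ _).prod (isCompact_Icc.prod isCompact_Icc)
  obtain ⟨⟨G, σ₀⟩, hG, φ, hφ, hlim⟩ := hK.tendsto_subseq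
    (x := fun j => (((g j : SeqSpace) : ℤ → ℂ), σ j)) (fun j => by
      refine ⟨fun n _ => ?_, hσ j, abs_le.mp (hσ₂ j)⟩
      rw [mem_closedBall_zero_iff]
      exact (lp.norm_apply_le_norm (by simp) _ n).trans (hgb j))
  have hlimG : Filter.Tendsto (fun j => ((g (φ j) : SeqSpace) : ℤ → ℂ)) Filter.atTop (𝓝 G) :=
    (continuous_fst.tendsto _).comp hlim
  have hlimσ : Filter.Tendsto (fun j => σ (φ j)) Filter.atTop (𝓝 σ₀) :=
    (continuous_snd.tendsto _).comp hlim
  have hGmem : Memℓp G 2 := lp.memℓp_of_tendsto (F := fun j => g (φ j))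
    ((isBounded_iff_forall_norm_le).mpr ⟨_, by rintro _ ⟨j, rfl⟩; exact hgb (φ j)⟩) hlimG
  set g₀ : SeqSpace := ⟨G, hGmem⟩
  have hpt : ∀ n, Filter.Tendsto (fun j => g (φ j) n) Filter.atTop (𝓝 (g₀ n)) :=
    fun n => (continuous_apply n).continuousAt.tendsto.comp hlimG
  have hW : Filter.Tendsto (fun j => weightOp (g (φ j))) Filter.atTop (𝓝 (weightOp g₀)) :=
    tendsto_weightOp_of_pointwise (fun j => hgb (φ j)) hpt
  have hg₀ : ‖weightOp g₀‖ = 1 := by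
    refine tendsto_nhds_unique hW.norm ?_
    simp [hg]
  have hVlim : Filter.Tendsto
      (fun j => (inner ℂ (V (weightOp (g (φ j)))) (weightOp (g (φ j)))).re) Filter.atTop
      (𝓝 (inner ℂ (V (weightOp g₀)) (weightOp g₀)).re) :=
    (Complex.continuous_re.tendsto _).comp (((V.continuous.tendsto _).comp hW).inner hW)
  -- The dispersion terms converge only mode by mode, but their norms are determined by `F` and the
  -- `V` term and hence converge. The norm can only drop in the pointwise limit, which is the
  -- direction that makes `F σ₀ g₀` large.
  have hYlim : Filter.Tendsto (fun j => ‖dispersionOp κ (σ (φ j)) (g (φ j))‖) Filter.atTop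
      (𝓝 (√((inner ℂ (V (weightOp g₀)) (weightOp g₀)).re - sSup S))) := by
    have h1 := (hVlim.sub (hxS'.comp hφ.tendsto_atTop)).sqrt
    refine h1.congr fun j => ?_
    simp [hF, Real.sqrt_sq]
  have hYpt : Filter.Tendsto (fun j => ((dispersionOp κ (σ (φ j)) (g (φ j)) : SeqSpace) : ℤ → ℂ))
      Filter.atTop (𝓝 (dispersionOp κ σ₀ g₀ : SeqSpace)) := by
    rw [tendsto_pi_nhds]
    intro n
    simp only [dispersionOp_apply, weightOp_apply]
    refine Filter.Tendsto.mul ?_ ((hpt n).const_mul _)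
    have : Continuous fun σ : ℝ × ℝ => (dispersion κ σ n : ℂ) := by
      unfold dispersion; fun_prop
    exact (this.tendsto _).comp hlimσ
  have hYle : ‖dispersionOp κ σ₀ g₀‖ ≤ √((inner ℂ (V (weightOp g₀)) (weightOp g₀)).re - sSup S) := by
    refine le_of_forall_gt_imp_ge_of_dense fun C hC => ?_
    exact lp.norm_le_of_tendsto (hYlim.eventually_le_const hC) hYpt
  have hnn : 0 ≤ (inner ℂ (V (weightOp g₀)) (weightOp g₀)).re - sSup S := by
    refine ge_of_tendsto' (hVlim.sub (hxS'.comp hφ.tendsto_atTop)) fun j => ?_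
    simp only [hF, Function.comp_apply, sub_sub_cancel]
    positivity
  have hmax : sSup S ≤ F σ₀ g₀ := by
    have h1 := pow_le_pow_left₀ (norm_nonneg _) hYle 2
    rw [Real.sq_sqrt hnn] at h1
    simp only [hF]
    linarith
  have hall : ∀ τ : ℝ × ℝ, τ.1 ∈ Icc (0 : ℝ) 1 → ∀ f,
      0 ≤ (inner ℂ (pencil κ V (τ, sSup S) f) f).re := by
    intro τ hτ f
    rw [re_inner_pencil]
    rcases eq_or_ne (weightOp f) 0 with hf | hf
    · simp only [hf, norm_zero, map_zero, inner_zero_left, Complex.zero_re]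
      nlinarith [sq_nonneg ‖dispersionOp κ τ f‖]
    · obtain ⟨f', hf', hFf⟩ := hscale τ f hf
      have h1 : F τ f' ≤ sSup S := le_csSup hbdd ⟨τ, hτ, f', hf', rfl⟩
      have h2 := mul_le_mul_of_nonneg_right h1 (sq_nonneg ‖weightOp f‖)
      rw [← hFf] at h2
      simp only [hF] at h2
      linarith
  refine ⟨sSup S, σ₀, g₀, hθS, hg₀, ?_, hall⟩
  refine eq_zero_of_forall_re_inner_nonneg (inner_pencil_left hV _) (hall σ₀ hG.2.1) ?_
  refine le_antisymm ?_ (hall σ₀ hG.2.1 g₀)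
  rw [re_inner_pencil, hg₀]
  simp only [hF] at hmax
  linarith

end Pencil

/-! ### Resonant pairs of modes and the spectral gap. -/

/-- Two resonant modes on the same side of the origin coincide. -/
theorem eq_of_abs_dispersion_lt {κ : ℝ} (hκ : 3 / 4 ≤ κ) {σ : ℝ × ℝ} {n m : ℤ}
    (hnm : 0 ≤ ((n : ℝ) + σ.1) * (m + σ.1))
    (hn : |dispersion κ σ n| < 1 / 4) (hm : |dispersion κ σ m| < 1 / 4) : n = m := by
  by_contra hne
  have h1 : (1 : ℝ) ≤ ((n : ℝ) - m) ^ 2 := by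
    have : 1 ≤ (n - m) ^ 2 := by
      have := sq_pos_of_ne_zero (sub_ne_zero.mpr hne)
      omega
    exact_mod_cast this
  obtain ⟨h2, h3⟩ := abs_lt.mp hn
  obtain ⟨h4, h5⟩ := abs_lt.mp hm
  simp only [dispersion] at h2 h3 h4 h5
  set k : ℝ := n + σ.1
  set l : ℝ := m + σ.1
  have h6 : ((n : ℝ) - m) = k - l := by simp only [k, l]; ring
  rw [h6] at h1
  -- For `k`, `l` of the same sign, `|k² - l²| ≥ (k - l)² ≥ 1`, so the two dispersion values differ
  -- by at least `κ ≥ 3/4`, more than `1/4 + 1/4`.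
  rcases le_total (k ^ 2) (l ^ 2) with h | h
  · have : 1 ≤ l ^ 2 - k ^ 2 := by
      have hkl : k ^ 2 ≤ k * l := by
        refine abs_le_of_sq_le_sq' ?_ hnm |>.2
        nlinarith [mul_le_mul_of_nonneg_left h (sq_nonneg k)]
      linarith
    nlinarith
  · have : 1 ≤ k ^ 2 - l ^ 2 := by
      have hkl : l ^ 2 ≤ k * l := by
        refine abs_le_of_sq_le_sq' ?_ hnm |>.2
        nlinarith [mul_le_mul_of_nonneg_left h (sq_nonneg l)]
      linarith
    nlinarith

/-- At most two modes are resonant. -/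
theorem exists_two_modes {κ : ℝ} (hκ : 3 / 4 ≤ κ) (σ : ℝ × ℝ) :
    ∃ n m : ℤ, n ≠ m ∧ ∀ j, j ≠ n → j ≠ m → 1 / 4 ≤ |dispersion κ σ j| := by
  have hn : ∃ n : ℤ, 0 ≤ (n : ℝ) + σ.1 ∧
      ∀ j : ℤ, 0 ≤ (j : ℝ) + σ.1 → j ≠ n → 1 / 4 ≤ |dispersion κ σ j| := by
    by_cases h : ∃ n : ℤ, 0 ≤ (n : ℝ) + σ.1 ∧ |dispersion κ σ n| < 1 / 4
    · obtain ⟨n, hn, hn'⟩ := h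
      refine ⟨n, hn, fun j hj hjn => ?_⟩
      by_contra hlt
      exact hjn (eq_of_abs_dispersion_lt hκ (mul_nonneg hj hn) (not_le.mp hlt) hn')
    · push Not at h
      -- Without a resonant mode on this side of `-σ₁` any index there serves; staying on this side
      -- keeps `n ≠ m`.
      exact ⟨⌈-σ.1⌉, by linarith [Int.le_ceil (-σ.1)], fun j hj _ => h j hj⟩
  have hm : ∃ m : ℤ, (m : ℝ) + σ.1 < 0 ∧
      ∀ j : ℤ, (j : ℝ) + σ.1 < 0 → j ≠ m → 1 / 4 ≤ |dispersion κ σ j| := by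
    by_cases h : ∃ m : ℤ, (m : ℝ) + σ.1 < 0 ∧ |dispersion κ σ m| < 1 / 4
    · obtain ⟨m, hm, hm'⟩ := h
      refine ⟨m, hm, fun j hj hjm => ?_⟩
      by_contra hlt
      exact hjm (eq_of_abs_dispersion_lt hκ (mul_nonneg_of_nonpos_of_nonpos hj.le hm.le)
        (not_le.mp hlt) hm')
    · push Not at h
      exact ⟨⌈-σ.1⌉ - 1, by push_cast; linarith [Int.ceil_lt_add_one (-σ.1)],
        fun j hj _ => h j hj⟩
  obtain ⟨n, hn, hn'⟩ := hn
  obtain ⟨m, hm, hm'⟩ := hm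
  refine ⟨n, m, ?_, fun j hjn hjm => ?_⟩
  · rintro rfl
    linarith
  · rcases le_or_gt 0 ((j : ℝ) + σ.1) with h | h
    · exact hn' j h hjn
    · exact hm' j h hjm

section Gap

variable {κ e t C : ℝ} {V V₀ : SeqSpace →L[ℂ] SeqSpace}

/-- The next-neighbour form of a sequence supported on two modes `n ≠ m`, with amplitudes opposite
with respect to the sign `s` of `t`, is nonpositive. -/
theorem neighbour_form_nonpos (hV₀ : ∀ (c : SeqSpace) n, V₀ c n = c (n - 1) + c (n + 1))
    {n m : ℤ} (hnm : n ≠ m) {s : ℝ} (hst : s * t = |t|) (b : ℂ) :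
    t * (inner ℂ (V₀ (lp.single 2 n (-(s : ℂ) * b) + lp.single 2 m b))
      (lp.single 2 n (-(s : ℂ) * b) + lp.single 2 m b)).re ≤ 0 := by
  rw [inner_add_right, lp.inner_single_right, lp.inner_single_right, hV₀, hV₀]
  have hb : 0 ≤ b.re * b.re + b.im * b.im := by nlinarith [sq_nonneg b.re, sq_nonneg b.im]
  have h1 : n - 1 ≠ n := by omega
  have h2 : n + 1 ≠ n := by omega
  have h3 : m - 1 ≠ m := by omega
  have h4 : m + 1 ≠ m := by omega
  -- When `m = n ± 1` the form equals `-2s |b|²`, so that multiplication by `t` gives `-2 |t| |b|²`;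
  -- otherwise the two modes do not interact.
  by_cases hp : m = n + 1
  · subst hp
    have h5 : n - 1 ≠ n + 1 := by omega
    have h6 : n + 1 + 1 ≠ n := by omega
    simp [lp.single_apply, h1, h5, h6]
    nlinarith [mul_nonneg (abs_nonneg t) hb]
  by_cases hq : m = n - 1
  · subst hq
    have h5 : n + 1 ≠ n - 1 := by omega
    have h6 : n - 1 - 1 ≠ n := by omega
    simp [lp.single_apply, h1, h5, h6]
    nlinarith [mul_nonneg (abs_nonneg t) hb]
  · have h5 : n - 1 ≠ m := by omega
    have h6 : n + 1 ≠ m := by omega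
    have h7 : m - 1 ≠ n := by omega
    have h8 : m + 1 ≠ n := by omega
    simp [lp.single_apply, h1, h2, h3, h4, h5, h6, h7, h8]

/-- On a subspace of codimension one, the quadratic form of every Bloch operator is at most
`e + O(t²)`. -/
theorem form_le_of_two_modes (ht : 64 * |t| ≤ 1)
    (hV₀ : ∀ (c : SeqSpace) n, V₀ c n = c (n - 1) + c (n + 1)) (hV₀n : ‖V₀‖ ≤ 2)
    (hVq : ∀ c, |(inner ℂ (V c) c).re - e * ‖c‖ ^ 2 - t * (inner ℂ (V₀ c) c).re|
      ≤ C * t ^ 2 * ‖c‖ ^ 2)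
    {σ : ℝ × ℝ} {n m : ℤ} (hnm : n ≠ m)
    (hdisp : ∀ j, j ≠ n → j ≠ m → 1 / 4 ≤ |dispersion κ σ j|)
    {s : ℝ} (hst : s * t = |t|) {g : SeqSpace}
    (hg : weightOp g n + s * weightOp g m = 0) :
    (inner ℂ (V (weightOp g)) (weightOp g)).re - ‖dispersionOp κ σ g‖ ^ 2
      ≤ (e + (C + 128) * t ^ 2) * ‖weightOp g‖ ^ 2 := by
  set c := weightOp g with hc
  -- By `hg`, `P` is the projection of `c` onto the two modes, and it has the opposite amplitudes
  -- for which the neighbour coupling cannot destabilize.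
  set P : SeqSpace := lp.single 2 n (-(s : ℂ) * c m) + lp.single 2 m (c m) with hP
  set Q : SeqSpace := c - P with hQ
  have hcP : c = P + Q := by simp [hQ]
  have hcn : c n = -(s : ℂ) * c m := by linear_combination hg
  have hPn : P n = c n := by
    rw [hcn]
    simp [hP, lp.single_apply, hnm]
  have hPm : P m = c m := by simp [hP, lp.single_apply, hnm.symm]
  have hQn : Q n = 0 := by
    have : Q n = c n - P n := rfl
    rw [this, hPn, sub_self]
  have hQm : Q m = 0 := by
    have : Q m = c m - P m := rfl
    rw [this, hPm, sub_self]
  have hQj : ∀ j, j ≠ n → j ≠ m → Q j = c j := by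
    intro j hjn hjm
    have : Q j = c j - (lp.single (E := fun _ : ℤ => ℂ) 2 n (-(s : ℂ) * c m) j
        + lp.single (E := fun _ : ℤ => ℂ) 2 m (c m) j) := rfl
    rw [this]
    simp [lp.single_apply, hjn, hjm]
  have hPQ : inner ℂ P Q = 0 := by
    rw [hP, inner_add_left, lp.inner_single_left, lp.inner_single_left, hQn, hQm]
    simp
  have hnorm : ‖c‖ ^ 2 = ‖P‖ ^ 2 + ‖Q‖ ^ 2 := by
    rw [hcP, sq, sq, sq]
    exact norm_add_sq_eq_norm_sq_add_norm_sq_of_inner_eq_zero P Q hPQ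
  have hY : ‖Q‖ ^ 2 ≤ 16 * ‖dispersionOp κ σ g‖ ^ 2 := by
    have := norm_sq_le_of_forall_le (f := Q) (g := dispersionOp κ σ g) (h := 0) (A := 16) (B := 0)
      fun j => ?_
    · simpa using this
    · rw [zero_mul, add_zero, dispersionOp_apply, norm_mul, mul_pow, ← hc]
      by_cases hjn : j = n
      · rw [hjn, hQn]; rw [norm_zero, zero_pow two_ne_zero]; positivity
      by_cases hjm : j = m
      · rw [hjm, hQm]; rw [norm_zero, zero_pow two_ne_zero]; positivity
      rw [hQj j hjn hjm, Complex.norm_real, Real.norm_eq_abs]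
      have h1 := hdisp j hjn hjm
      nlinarith [mul_le_mul_of_nonneg_right (pow_le_pow_left₀ (by norm_num) h1 2)
        (sq_nonneg ‖c j‖)]
  have hB : ∀ x y : SeqSpace, |(inner ℂ (V₀ x) y).re| ≤ 2 * (‖x‖ * ‖y‖) := by
    intro x y
    calc |(inner ℂ (V₀ x) y).re| ≤ ‖inner ℂ (V₀ x) y‖ := Complex.abs_re_le_norm _
      _ ≤ ‖V₀ x‖ * ‖y‖ := norm_inner_le_norm _ _
      _ ≤ 2 * ‖x‖ * ‖y‖ := by
        gcongr
        exact (V₀.le_opNorm x).trans (by gcongr)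
      _ = _ := by ring
  have htB : ∀ x y : SeqSpace, t * (inner ℂ (V₀ x) y).re ≤ |t| * (2 * (‖x‖ * ‖y‖)) := by
    intro x y
    calc t * (inner ℂ (V₀ x) y).re ≤ |t * (inner ℂ (V₀ x) y).re| := le_abs_self _
      _ = |t| * |(inner ℂ (V₀ x) y).re| := abs_mul _ _
      _ ≤ _ := by gcongr; exact hB x y
  have hsplit : t * (inner ℂ (V₀ c) c).re ≤ |t| * (4 * (‖P‖ * ‖Q‖)) + |t| * (2 * ‖Q‖ ^ 2) := by
    have h1 := neighbour_form_nonpos hV₀ hnm hst (c m)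
    rw [← hP] at h1
    have h2 := htB P Q
    have h3 := htB Q P
    have h4 := htB Q Q
    have h5 : (inner ℂ (V₀ c) c).re = (inner ℂ (V₀ P) P).re + (inner ℂ (V₀ P) Q).re
        + (inner ℂ (V₀ Q) P).re + (inner ℂ (V₀ Q) Q).re := by
      rw [hcP, map_add, inner_add_left, inner_add_right (V₀ P), inner_add_right (V₀ Q)]
      simp only [Complex.add_re]
      ring
    rw [h5]
    nlinarith
  have hV1 := (abs_le.mp (hVq c)).2
  -- The losses in `‖Q‖²` are `1/32` here and `1/32` from `64 |t| ≤ 1`; together they are absorbed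
  -- by `‖Q‖² / 16 ≤ ‖dispersionOp κ σ g‖²`. The price in Young's inequality is the constant `128`.
  have h6 : |t| * (4 * (‖P‖ * ‖Q‖)) ≤ 1 / 32 * ‖Q‖ ^ 2 + 128 * t ^ 2 * ‖P‖ ^ 2 := by
    rw [← sq_abs t]
    nlinarith [sq_nonneg (‖Q‖ - 64 * (|t| * ‖P‖))]
  have h7 : |t| * (2 * ‖Q‖ ^ 2) ≤ 1 / 32 * ‖Q‖ ^ 2 := by nlinarith [sq_nonneg ‖Q‖]
  have h8 : 128 * t ^ 2 * ‖P‖ ^ 2 ≤ 128 * t ^ 2 * ‖c‖ ^ 2 := by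
    gcongr ?_ * ?_
    nlinarith [sq_nonneg ‖Q‖]
  nlinarith

/-- The resonant pair of modes at `σ₁ = 1/2` gives a growth rate of order `|t|`. -/
theorem exists_resonant_test (hκ : κ ≤ 4)
    (hV₀ : ∀ (c : SeqSpace) n, V₀ c n = c (n - 1) + c (n + 1))
    (hVq : ∀ c, |(inner ℂ (V c) c).re - e * ‖c‖ ^ 2 - t * (inner ℂ (V₀ c) c).re|
      ≤ C * t ^ 2 * ‖c‖ ^ 2) {s : ℝ} (hs : s ^ 2 = 1) (hst : s * t = |t|) :
    ∃ σ : ℝ × ℝ, σ.1 ∈ Icc (0 : ℝ) 1 ∧ ∃ g : SeqSpace, weightOp g ≠ 0 ∧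
      (e + |t| - C * t ^ 2) * ‖weightOp g‖ ^ 2 ≤
        (inner ℂ (V (weightOp g)) (weightOp g)).re - ‖dispersionOp κ σ g‖ ^ 2 := by
  set c : SeqSpace := lp.single 2 0 1 + lp.single 2 (-1) (s : ℂ) with hc
  -- `g = W⁻¹ c`: the weight is `1` at mode `0` and `1/2` at mode `-1`.
  set g : SeqSpace := lp.single 2 0 1 + lp.single 2 (-1) (2 * (s : ℂ)) with hg
  have hgc : weightOp g = c := by
    ext n
    rw [weightOp_apply]
    have h1 : g n = lp.single (E := fun _ : ℤ => ℂ) 2 0 1 n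
      + lp.single (E := fun _ : ℤ => ℂ) 2 (-1) (2 * (s : ℂ)) n := rfl
    have h2 : c n = lp.single (E := fun _ : ℤ => ℂ) 2 0 1 n
      + lp.single (E := fun _ : ℤ => ℂ) 2 (-1) (s : ℂ) n := rfl
    rw [h1, h2]
    simp only [lp.single_apply, Pi.single_apply]
    by_cases h0 : n = 0
    · subst h0; simp
    by_cases h1 : n = -1
    · subst h1; norm_num; ring
    · simp [h0, h1]
  have hc0 : c 0 = 1 := by simp [hc, lp.single_apply]
  have hc1 : c (-1) = s := by simp [hc, lp.single_apply]
  have hcj : ∀ n, n ≠ 0 → n ≠ -1 → c n = 0 := by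
    intro n h0 h1
    simp [hc, lp.single_apply, h0, h1]
  have hnorm : ‖c‖ ^ 2 = 2 := by
    have h1 : inner ℂ c c = (2 : ℂ) := by
      nth_rewrite 1 [hc]
      rw [inner_add_left, lp.inner_single_left, lp.inner_single_left, hc0, hc1]
      simp [← Complex.ofReal_pow, hs, one_add_one_eq_two]
    rw [inner_self_eq_ofReal_norm_sq] at h1
    exact_mod_cast h1
  have hform : (inner ℂ (V₀ c) c).re = 2 * s := by
    nth_rewrite 2 [hc]
    rw [inner_add_right, lp.inner_single_right, lp.inner_single_right, hV₀, hV₀,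
      show (0 : ℤ) - 1 = -1 by norm_num, show (-1 : ℤ) + 1 = 0 by norm_num, hc0, hc1,
      hcj (0 + 1) (by norm_num) (by norm_num), hcj (-1 - 1) (by norm_num) (by norm_num)]
    simp
    ring
  -- Both modes satisfy `(n + 1/2)² = 1/4`, so this `σ₂` annihilates both dispersion values; `κ ≤ 4`
  -- makes the root available.
  refine ⟨(1 / 2, √(1 - κ / 4)), by norm_num, g, ?_, ?_⟩
  · rw [hgc]
    intro h
    rw [h] at hnorm
    simp at hnorm
  · have hY : dispersionOp κ (1 / 2, √(1 - κ / 4)) g = 0 := by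
      ext n
      rw [dispersionOp_apply, hgc]
      have hsq : √(1 - κ / 4) ^ 2 = 1 - κ / 4 := Real.sq_sqrt (by linarith)
      by_cases h0 : n = 0
      · subst h0
        have : dispersion κ (1 / 2, √(1 - κ / 4)) 0 = 0 := by
          simp only [dispersion, hsq]; push_cast; ring
        rw [this, Complex.ofReal_zero, zero_mul]; rfl
      by_cases h1 : n = -1
      · subst h1
        have : dispersion κ (1 / 2, √(1 - κ / 4)) (-1) = 0 := by
          simp only [dispersion, hsq]; push_cast; ring
        rw [this, Complex.ofReal_zero, zero_mul]; rfl
      · simp [hcj n h0 h1]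
    have h1 := (abs_le.mp (hVq c)).1
    rw [hY, hgc]
    rw [hform, hnorm] at h1
    rw [hnorm, norm_zero]
    nlinarith

end Gap

/-! ### Bordered pencil and analytic continuation of a simple eigenvalue. -/

/-- The rank one operator `g ↦ ⟪k, g⟫ k`. -/
noncomputable def rankOneOp (k : SeqSpace) : SeqSpace →L[ℂ] SeqSpace :=
  (innerSL ℂ k).smulRight k

theorem rankOneOp_apply (k g : SeqSpace) : rankOneOp k g = inner ℂ k g • k := rfl

section Bordered

variable {κ : ℝ} {V : SeqSpace →L[ℂ] SeqSpace}

/-- The pencil plus the rank one operator along `k` is analytic in its parameters. -/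
theorem analyticAt_borderedPencil (k : SeqSpace) (p : (ℝ × ℝ) × ℝ) :
    AnalyticAt ℝ (fun p => pencil κ V p + rankOneOp k) p := by
  unfold pencil dispersionOp
  -- The order of differentiability here is the analytic one; it is available because the pencil is
  -- polynomial in `(σ, μ)` with bounded operator coefficients.
  refine ContDiffAt.analyticAt (𝕜 := ℝ) ?_
  fun_prop

theorem inner_borderedPencil_left (hV : ∀ f g, inner ℂ (V f) g = inner ℂ f (V g)) (k : SeqSpace)
    (p : (ℝ × ℝ) × ℝ) (f g : SeqSpace) :
    inner ℂ ((pencil κ V p + rankOneOp k) f) g = inner ℂ f ((pencil κ V p + rankOneOp k) g) := by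
  simp only [_root_.add_apply, inner_add_left, inner_add_right,
    inner_pencil_left hV, rankOneOp_apply, inner_smul_left, inner_smul_right, inner_conj_symm]
  ring

/-- If the kernel of the pencil is spanned by `g₀` up to a gap, the bordered pencil is
invertible. -/
theorem isUnit_borderedPencil (hκ : 3 / 4 ≤ κ) (hV : ∀ f g, inner ℂ (V f) g = inner ℂ f (V g))
    {p : (ℝ × ℝ) × ℝ} (hp : 0 ≤ p.2) {g₀ : SeqSpace} (hg₀ : ‖weightOp g₀‖ = 1)
    (hker : pencil κ V p g₀ = 0) {γ : ℝ} (hγ : 0 < γ)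
    (hgap : ∀ g, inner ℂ (weightOp (weightOp g₀)) g = 0 →
      γ * ‖weightOp g‖ ^ 2 ≤ (inner ℂ (pencil κ V p g) g).re) :
    IsUnit (pencil κ V p + rankOneOp (weightOp (weightOp g₀))) := by
  set k := weightOp (weightOp g₀) with hk
  have hkk : inner ℂ k g₀ = 1 := by
    rw [hk, inner_weightOp_left, inner_self_eq_ofReal_norm_sq, hg₀]; norm_num
  have hform : ∀ g, min γ 1 * ‖weightOp g‖ ^ 2
      ≤ (inner ℂ ((pencil κ V p + rankOneOp k) g) g).re := by
    intro g
    -- Since `⟨k, g₀⟩ = 1`, this splits `g` orthogonally for the weighted product `⟨W f, W g⟩`: the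
    -- rank one term controls the `g₀` component and the gap controls `h`.
    set z := inner ℂ k g with hz
    set h := g - z • g₀ with hh
    have hkh : inner ℂ k h = 0 := by
      rw [hh, inner_sub_right, inner_smul_right, hkk, ← hz, mul_one, sub_self]
    have hgh : g = h + z • g₀ := by simp [hh]
    have h1 : inner ℂ (pencil κ V p g) g = inner ℂ (pencil κ V p h) h := by
      have e1 : pencil κ V p g = pencil κ V p h := by rw [hgh, map_add, map_smul, hker]; simp
      rw [e1, inner_pencil_left hV, e1, inner_pencil_left hV]
    have h2 : inner ℂ (rankOneOp k g) g = ((‖z‖ ^ 2 : ℝ) : ℂ) := by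
      rw [rankOneOp_apply, inner_smul_left, ← hz, mul_comm, Complex.mul_conj,
        Complex.normSq_eq_norm_sq]
    have h3 : ‖weightOp g‖ ^ 2 = ‖weightOp h‖ ^ 2 + ‖z‖ ^ 2 := by
      have e1 : weightOp g = weightOp h + z • weightOp g₀ := by rw [hgh, map_add, map_smul]
      have e2 : inner ℂ (weightOp h) (z • weightOp g₀) = 0 := by
        rw [inner_smul_right, inner_weightOp_left, ← inner_conj_symm, hkh]; simp
      have := norm_add_sq_eq_norm_sq_add_norm_sq_of_inner_eq_zero _ _ e2
      rw [← e1, norm_smul, hg₀, mul_one] at this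
      simpa [sq] using this
    rw [_root_.add_apply, inner_add_left, h1, h2, Complex.add_re, Complex.ofReal_re,
      h3, mul_add]
    refine add_le_add (le_trans ?_ (hgap h hkh)) ?_
    · exact mul_le_mul_of_nonneg_right (min_le_left _ _) (sq_nonneg _)
    · exact mul_le_of_le_one_left (sq_nonneg _) (min_le_right _ _)
  set γ₁ := min γ 1 with hγ₁
  have hγ₁0 : 0 < γ₁ := lt_min hγ one_pos
  set K := 2 * (4 + 2 * p.1.1 ^ 2) ^ 2 with hK
  have hK0 : 0 < K := by positivity
  -- Lax–Milgram needs a bound on the full norm of `g`. The form `q` controls `‖W g‖²` by the gap,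
  -- hence the dispersion term, and these two control `‖g‖²` by coercivity.
  set c : ℝ := (K * (γ₁⁻¹ + (1 + ‖V‖ * γ₁⁻¹)))⁻¹ with hc
  have hc0 : 0 < c := by positivity
  refine ContinuousLinearMap.isUnit_of_forall_le_norm_inner_map _ (c := ⟨c, hc0.le⟩) hc0 fun g => ?_
  refine le_trans ?_ (Complex.re_le_norm _)
  set q := (inner ℂ ((pencil κ V p + rankOneOp k) g) g).re with hq
  have h1 : ‖weightOp g‖ ^ 2 ≤ γ₁⁻¹ * q := by
    rw [← div_eq_inv_mul, le_div_iff₀ hγ₁0]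
    linarith [hform g]
  have h2 : ‖dispersionOp κ p.1 g‖ ^ 2 ≤ (1 + ‖V‖ * γ₁⁻¹) * q := by
    have e1 : ‖dispersionOp κ p.1 g‖ ^ 2 - ‖V‖ * ‖weightOp g‖ ^ 2 ≤ q := by
      rw [hq, _root_.add_apply, inner_add_left, Complex.add_re, re_inner_pencil,
        rankOneOp_apply, inner_smul_left, mul_comm _ (inner ℂ k g), Complex.mul_conj,
        Complex.ofReal_re]
      have := re_inner_le_opNorm V (weightOp g)
      have := Complex.normSq_nonneg (inner ℂ k g)
      have := mul_nonneg hp (sq_nonneg ‖weightOp g‖)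
      linarith
    have e2 := mul_le_mul_of_nonneg_left h1 (norm_nonneg V)
    linarith
  have h3 := norm_sq_le_dispersionOp hκ p.1 g
  change ‖g‖ ^ 2 * c ≤ q
  rw [hc, ← div_eq_mul_inv, div_le_iff₀ (by positivity)]
  calc ‖g‖ ^ 2 ≤ K * (‖weightOp g‖ ^ 2 + ‖dispersionOp κ p.1 g‖ ^ 2) := h3
    _ ≤ K * (γ₁⁻¹ * q + (1 + ‖V‖ * γ₁⁻¹) * q) := by gcongr
    _ = _ := by ring

/-- A simple isolated eigenvalue continues analytically in the Floquet parameter. -/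
theorem exists_analytic_eigenvalue (hV : ∀ f g, inner ℂ (V f) g = inner ℂ f (V g))
    {σ₀ : ℝ × ℝ} {lam₀ : ℝ} {g₀ : SeqSpace} (hg₀ : ‖weightOp g₀‖ = 1)
    (hker : pencil κ V (σ₀, lam₀) g₀ = 0)
    (hunit : IsUnit (pencil κ V (σ₀, lam₀) + rankOneOp (weightOp (weightOp g₀)))) :
    ∃ lam : ℝ × ℝ → ℝ, AnalyticAt ℝ lam σ₀ ∧ lam σ₀ = lam₀ ∧
      ∀ᶠ σ in 𝓝 σ₀, ∃ g, g ≠ 0 ∧ pencil κ V (σ, lam σ) g = 0 := by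
  set k := weightOp (weightOp g₀) with hk
  have hkk : inner ℂ k g₀ = 1 := by
    rw [hk, inner_weightOp_left, inner_self_eq_ofReal_norm_sq, hg₀]; norm_num
  set A : (ℝ × ℝ) × ℝ → SeqSpace →L[ℂ] SeqSpace := fun p => pencil κ V p + rankOneOp k with hA
  have hAan : ∀ p, AnalyticAt ℝ A p := fun p => analyticAt_borderedPencil k p
  have hAcont : Continuous A := continuous_iff_continuousAt.mpr fun p => (hAan p).continuousAt
  let L : (SeqSpace →L[ℂ] SeqSpace) →L[ℝ] ℝ :=
    Complex.reCLM ∘L ((innerSL ℂ k) ∘L ContinuousLinearMap.apply ℂ SeqSpace k).restrictScalars ℝ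
  have hL : ∀ B : SeqSpace →L[ℂ] SeqSpace, L B = (inner ℂ k (B k)).re := fun B => rfl
  -- If `z = A⁻¹ k`, then `pencil z = (1 - ⟨k, z⟩) k`, so the eigenvalue equation is the scalar
  -- equation `H = 1`. On the line `σ = σ₀` the function `H` is `1 / (1 + μ - λ₀)`, whose slope `-1`
  -- at `λ₀` lets `μ` be solved for.
  set H : (ℝ × ℝ) × ℝ → ℝ := fun p => L (Ring.inverse (A p)) with hH
  have hopen : ∀ᶠ p in 𝓝 (σ₀, lam₀), IsUnit (A p) :=
    hAcont.continuousAt.eventually (Units.isOpen.mem_nhds hunit)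
  have hinv : AnalyticAt ℝ Ring.inverse (A (σ₀, lam₀)) := by
    obtain ⟨U, hU⟩ := hunit
    have := analyticAt_inverse (𝕜 := ℝ) U
    rwa [hU] at this
  have hHan : AnalyticAt ℝ H (σ₀, lam₀) :=
    (L.analyticAt _).comp (hinv.comp (hAan _))
  have hsolve : ∀ p, IsUnit (A p) → A p (Ring.inverse (A p) k) = k := by
    intro p hp
    have := Ring.mul_inverse_cancel _ hp
    exact congrArg (fun B : SeqSpace →L[ℂ] SeqSpace => B k) this
  have hHline : ∀ᶠ μ in 𝓝 lam₀, H (σ₀, μ) = (1 + (μ - lam₀))⁻¹ := by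
    have h1 : ∀ᶠ μ in 𝓝 lam₀, IsUnit (A (σ₀, μ)) :=
      (Continuous.prodMk_right σ₀).continuousAt.eventually hopen
    have h2 : ∀ᶠ μ : ℝ in 𝓝 lam₀, 1 + (μ - lam₀) ≠ 0 := by
      have : ContinuousAt (fun μ : ℝ => 1 + (μ - lam₀)) lam₀ := by fun_prop
      exact this.eventually_ne (by simp)
    filter_upwards [h1, h2] with μ hμ hμ'
    have h3 : A (σ₀, μ) g₀ = ((1 + (μ - lam₀) : ℝ) : ℂ) • k := by
      have e1 : pencil κ V (σ₀, μ) g₀ = pencil κ V (σ₀, lam₀) g₀ + ((μ - lam₀ : ℝ) : ℂ) • k := by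
        simp only [pencil_apply, ← hk]
        push_cast
        module
      simp only [hA, _root_.add_apply, e1, hker, rankOneOp_apply, hkk]
      push_cast
      module
    have h4 : Ring.inverse (A (σ₀, μ)) k = ((1 + (μ - lam₀) : ℝ) : ℂ)⁻¹ • g₀ := by
      have e1 := Ring.inverse_mul_cancel _ hμ
      have e2 := congrArg (fun B : SeqSpace →L[ℂ] SeqSpace => B g₀) e1
      simp only [mul_apply_eq_comp, h3, map_smul, one_apply_eq_self] at e2
      rw [← e2, smul_smul, inv_mul_cancel₀ (by exact_mod_cast hμ'), one_smul]
    rw [hH]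
    simp only [hL, h4, inner_smul_right, hkk, mul_one]
    rw [← Complex.ofReal_inv, Complex.ofReal_re]
  have hH0 : H (σ₀, lam₀) = 1 := by
    rw [hHline.self_of_nhds]; simp
  -- The exponent `⊤` is the analytic class, so the implicit function is analytic and not merely
  -- smooth.
  have hcd : ContDiffAt ℝ (⊤ : WithTop ℕ∞) H (σ₀, lam₀) := hHan.contDiffAt
  have hinvertible : (fderiv ℝ H (σ₀, lam₀) ∘L .inr ℝ (ℝ × ℝ) ℝ).IsInvertible := by
    have h1 : HasDerivAt (fun μ => H (σ₀, μ)) (-1) lam₀ := by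
      have e1 : HasDerivAt (fun μ : ℝ => (1 + (μ - lam₀))⁻¹) (-1) lam₀ := by
        have e2 : HasDerivAt (fun μ : ℝ => 1 + (μ - lam₀)) 1 lam₀ :=
          ((hasDerivAt_id lam₀).sub_const lam₀).const_add 1
        exact (e2.inv (by simp)).congr_deriv (by simp)
      exact e1.congr_of_eventuallyEq hHline
    have h2 : HasFDerivAt (fun μ => H (σ₀, μ))
        (fderiv ℝ H (σ₀, lam₀) ∘L .inr ℝ (ℝ × ℝ) ℝ) lam₀ :=
      hHan.differentiableAt.hasFDerivAt.comp lam₀ (hasFDerivAt_prodMk_right σ₀ lam₀)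
    rw [h2.unique h1.hasFDerivAt]
    exact ⟨ContinuousLinearEquiv.unitsEquivAut ℝ (-1), by ext; simp⟩
  refine ⟨hcd.implicitFunction (by simp) hinvertible,
    (hcd.contDiffAt_implicitFunction (by simp) hinvertible).analyticAt,
    hcd.implicitFunction_apply_self (by simp) hinvertible, ?_⟩
  set lam := hcd.implicitFunction (by simp) hinvertible with hlam
  have hlan : ContinuousAt lam σ₀ :=
    (hcd.contDiffAt_implicitFunction (by simp) hinvertible).continuousAt
  have hlam0 : lam σ₀ = lam₀ := hcd.implicitFunction_apply_self (by simp) hinvertible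
  have hunit' : ∀ᶠ σ in 𝓝 σ₀, IsUnit (A (σ, lam σ)) := by
    have : Filter.Tendsto (fun σ => (σ, lam σ)) (𝓝 σ₀) (𝓝 (σ₀, lam₀)) := by
      rw [← hlam0]
      exact continuousAt_id.prodMk hlan
    exact this.eventually hopen
  filter_upwards [hcd.eventually_apply_implicitFunction (by simp) hinvertible, hunit']
    with σ hσ hσu
  set z := Ring.inverse (A (σ, lam σ)) k with hz
  have hAz : A (σ, lam σ) z = k := hsolve _ hσu
  have hre : (inner ℂ k z).re = 1 := by
    have : H (σ, lam σ) = 1 := hσ.trans hH0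
    exact this
  -- `H` records only a real part. The product is real anyway, because `⟨k, z⟩ = ⟨A z, z⟩` with `A`
  -- symmetric.
  have him : (inner ℂ k z).im = 0 := by
    have e1 : inner ℂ k z = inner ℂ z k := by
      conv_lhs => rw [← hAz]
      conv_rhs => rw [← hAz]
      exact inner_borderedPencil_left hV k _ z z
    have e2 := congrArg Complex.im e1
    rw [← inner_conj_symm z k, Complex.conj_im] at e2
    linarith
  have hkz : inner ℂ k z = 1 := Complex.ext hre (by simpa using him)
  refine ⟨z, ?_, ?_⟩
  · intro h0
    rw [h0, inner_zero_right] at hkz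
    exact zero_ne_one hkz
  · have : pencil κ V (σ, lam σ) z + inner ℂ k z • k = k := hAz
    rw [hkz, one_smul] at this
    simpa using this

end Bordered

/-- Existence of a maximal, simple unstable eigenvalue and its analytic continuation, for a
next-neighbour coupling of strength `t` perturbed at order `t²`. -/
theorem exists_maximal_eigenvalue {κ e t C : ℝ} {V V₀ : SeqSpace →L[ℂ] SeqSpace}
    (hκ : 3 / 4 ≤ κ) (hκ' : κ ≤ 4) (he : 0 ≤ e) (hC : 0 ≤ C) (ht : t ≠ 0)
    (htC : (2 * C + 128) * |t| < 1)
    (hV : ∀ f g, inner ℂ (V f) g = inner ℂ f (V g))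
    (hV₀ : ∀ (c : SeqSpace) n, V₀ c n = c (n - 1) + c (n + 1)) (hV₀n : ‖V₀‖ ≤ 2)
    (hVq : ∀ c, |(inner ℂ (V c) c).re - e * ‖c‖ ^ 2 - t * (inner ℂ (V₀ c) c).re|
      ≤ C * t ^ 2 * ‖c‖ ^ 2) :
    ∃ (lam₀ : ℝ) (σ₀ : ℝ × ℝ), 0 < lam₀ ∧ (∃ g, g ≠ 0 ∧ pencil κ V (σ₀, lam₀) g = 0) ∧
      (∀ (σ : ℝ × ℝ) (μ : ℝ), σ.1 ∈ Icc (0 : ℝ) 1 →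
        (∃ g, g ≠ 0 ∧ pencil κ V (σ, μ) g = 0) → μ ≤ lam₀) ∧
      ∃ (N : Set (ℝ × ℝ)) (lam : ℝ × ℝ → ℝ), IsOpen N ∧ σ₀ ∈ N ∧ AnalyticOnNhd ℝ lam N ∧
        lam σ₀ = lam₀ ∧ ∀ σ ∈ N, 0 < lam σ ∧ ∃ g, g ≠ 0 ∧ pencil κ V (σ, lam σ) g = 0 := by
  have ht0 : 0 < |t| := abs_pos.mpr ht
  obtain ⟨s, hs, hst⟩ : ∃ s : ℝ, s ^ 2 = 1 ∧ s * t = |t| := by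
    rcases le_total 0 t with h | h
    · exact ⟨1, by norm_num, by rw [abs_of_nonneg h, one_mul]⟩
    · exact ⟨-1, by norm_num, by rw [abs_of_nonpos h]; ring⟩
  have ht64 : 64 * |t| ≤ 1 := by nlinarith
  -- This separates the lower bound `e + |t| - C t²` for the maximum from the upper bound `e + (C +
  -- 128) t²` on the subspace of codimension one.
  have hgapt : (2 * C + 128) * t ^ 2 < |t| := by
    rw [← sq_abs t]; nlinarith
  have hθ : 0 < e + |t| - C * t ^ 2 := by nlinarith [mul_nonneg hC (sq_nonneg t)]
  obtain ⟨lam₀, σ₀, g₀, hlam₀, hg₀, hker, hmax⟩ :=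
    exists_maximizer hκ hV hθ (exists_resonant_test hκ' hV₀ hVq hs hst)
  have hpos : 0 < lam₀ := hθ.trans_le hlam₀
  have hne : ∀ g : SeqSpace, g ≠ 0 → 0 < ‖weightOp g‖ ^ 2 := fun g hg => by
    have : weightOp g ≠ 0 := fun h => hg (weightOp_injective (h.trans (map_zero _).symm))
    exact pow_pos (norm_pos_iff.mpr this) 2
  have hg₀ne : g₀ ≠ 0 := by
    rintro rfl
    simp at hg₀
  set τ := e + (C + 128) * t ^ 2 with hτ
  have hτlam : τ < lam₀ := by
    simp only [hτ]; nlinarith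
  obtain ⟨n, m, hnm, hdisp⟩ := exists_two_modes hκ σ₀
  have hform : ∀ g, weightOp g n + s * weightOp g m = 0 →
      (lam₀ - τ) * ‖weightOp g‖ ^ 2 ≤ (inner ℂ (pencil κ V (σ₀, lam₀) g) g).re := by
    intro g hg
    have := form_le_of_two_modes ht64 hV₀ hV₀n hVq hnm hdisp hst hg
    rw [re_inner_pencil]
    linarith
  -- A kernel vector annihilated by the functional would lie in the subspace where the form is
  -- strictly positive.
  have hℓ : weightOp g₀ n + s * weightOp g₀ m ≠ 0 := by
    intro h
    have h1 := hform g₀ h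
    rw [hker, inner_zero_left, hg₀] at h1
    simp at h1
    linarith
  have hunit : IsUnit (pencil κ V (σ₀, lam₀) + rankOneOp (weightOp (weightOp g₀))) := by
    refine isUnit_borderedPencil hκ hV hpos.le hg₀ hker (sub_pos.mpr hτlam) fun g hg => ?_
    -- The gap passes from the kernel of the functional to the weighted orthogonal complement of
    -- `g₀`: subtracting a multiple of `g₀` leaves the pencil form unchanged and, by Pythagoras,
    -- does not decrease `‖W g‖`.
    set z : ℂ := (weightOp g n + s * weightOp g m) / (weightOp g₀ n + s * weightOp g₀ m) with hz
    set f := g - z • g₀ with hf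
    have hWf : weightOp f = weightOp g - z • weightOp g₀ := by rw [hf, map_sub, map_smul]
    have hf0 : weightOp f n + s * weightOp f m = 0 := by
      have e1 : ∀ j, weightOp f j = weightOp g j - z * weightOp g₀ j := fun j => by
        rw [hWf]; rfl
      rw [e1, e1]
      have e2 : z * (weightOp g₀ n + s * weightOp g₀ m) = weightOp g n + s * weightOp g m :=
        div_mul_cancel₀ _ hℓ
      linear_combination -e2
    have h1 := hform f hf0
    have e1 : pencil κ V (σ₀, lam₀) f = pencil κ V (σ₀, lam₀) g := by
      rw [hf, map_sub, map_smul, hker, smul_zero, sub_zero]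
    rw [e1, inner_pencil_left hV, e1, ← inner_pencil_left hV] at h1
    refine le_trans (mul_le_mul_of_nonneg_left ?_ (sub_pos.mpr hτlam).le) h1
    have e2 : inner ℂ (weightOp g) (-(z • weightOp g₀)) = 0 := by
      rw [inner_neg_right, inner_smul_right, inner_weightOp_left, ← inner_conj_symm, hg]; simp
    have e3 := norm_add_sq_eq_norm_sq_add_norm_sq_of_inner_eq_zero _ _ e2
    rw [← sub_eq_add_neg, ← hWf] at e3
    nlinarith [mul_self_nonneg ‖-(z • weightOp g₀)‖]
  obtain ⟨lam, han, hlam0, hev⟩ := exists_analytic_eigenvalue hV hg₀ hker hunit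
  refine ⟨lam₀, σ₀, hpos, ⟨g₀, hg₀ne, hker⟩, ?_, ?_⟩
  · rintro σ μ hσ ⟨g, hg, hgμ⟩
    have h1 := hmax σ hσ g
    have h2 : (inner ℂ (pencil κ V (σ, μ) g) g).re = 0 := by rw [hgμ, inner_zero_left]; rfl
    rw [re_inner_pencil] at h1 h2
    have h3 := hne g hg
    simp only at h1 h2
    by_contra hlt
    push Not at hlt
    nlinarith
  · have hev' : ∀ᶠ σ in 𝓝 σ₀, AnalyticAt ℝ lam σ ∧ 0 < lam σ ∧
        ∃ g, g ≠ 0 ∧ pencil κ V (σ, lam σ) g = 0 := by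
      filter_upwards [han.eventually_analyticAt, hev,
        han.continuousAt.eventually_const_lt (hlam0.symm ▸ hpos)] with σ h1 h2 h3
      exact ⟨h1, h3, h2⟩
    obtain ⟨N, hN, hNo, hσN⟩ := eventually_nhds_iff.mp hev'
    exact ⟨N, lam, hNo, hσN, fun σ hσ => (hN σ hσ).1, hlam0, fun σ hσ => (hN σ hσ).2⟩

/-! ### Multiplication operators and the Bloch operator in Fourier coefficients. -/

theorem mulL2_ae (φ : C(Torus, ℂ)) (f : L2Torus) :
    mulL2 φ f =ᵐ[AddCircle.haarAddCircle] fun x => φ x * f x := by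
  have h1 := Lp.coeFn_lpSMul (r := 2)
    (ContinuousMap.toLp ∞ AddCircle.haarAddCircle ℂ φ : Lp ℂ ∞ _) f
  have h2 := ContinuousMap.coeFn_toLp (p := ∞) (𝕜 := ℂ) AddCircle.haarAddCircle φ
  refine h1.trans ?_
  filter_upwards [h2] with x hx
  rw [Pi.smul_apply', hx, smul_eq_mul]

theorem norm_mulL2_le (φ : C(Torus, ℂ)) (f : L2Torus) : ‖mulL2 φ f‖ ≤ ‖φ‖ * ‖f‖ := by
  refine (Lp.norm_smul_le (r := 2)
    (ContinuousMap.toLp ∞ AddCircle.haarAddCircle ℂ φ : Lp ℂ ∞ _) f).trans ?_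
  gcongr
  have h := ContinuousLinearMap.le_of_opNorm_le _
    (ContinuousMap.toLp_norm_le (p := ∞) (μ := AddCircle.haarAddCircle (T := 2 * π)) (E := ℂ)
      (𝕜 := ℂ)) φ
  simpa using h

theorem mulL2_add (φ ψ : C(Torus, ℂ)) (f : L2Torus) :
    mulL2 (φ + ψ) f = mulL2 φ f + mulL2 ψ f := by
  refine Lp.ext ?_
  filter_upwards [mulL2_ae (φ + ψ) f, mulL2_ae φ f, mulL2_ae ψ f,
    Lp.coeFn_add (mulL2 φ f) (mulL2 ψ f)] with x h1 h2 h3 h4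
  rw [h1, h4, Pi.add_apply, h2, h3, ContinuousMap.add_apply, add_mul]

theorem mulL2_smul (a : ℂ) (φ : C(Torus, ℂ)) (f : L2Torus) :
    mulL2 (a • φ) f = a • mulL2 φ f := by
  refine Lp.ext ?_
  filter_upwards [mulL2_ae (a • φ) f, mulL2_ae φ f, Lp.coeFn_smul a (mulL2 φ f)] with x h1 h2 h3
  rw [h1, h3, Pi.smul_apply, h2, ContinuousMap.smul_apply, smul_mul_assoc]

theorem mulL2_one (f : L2Torus) : mulL2 1 f = f := by
  refine Lp.ext ?_
  filter_upwards [mulL2_ae 1 f] with x h1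
  rw [h1, ContinuousMap.one_apply, one_mul]

theorem mulL2_mul (φ ψ : C(Torus, ℂ)) (f : L2Torus) :
    mulL2 φ (mulL2 ψ f) = mulL2 ψ (mulL2 φ f) := by
  refine Lp.ext ?_
  filter_upwards [mulL2_ae φ (mulL2 ψ f), mulL2_ae ψ (mulL2 φ f), mulL2_ae φ f, mulL2_ae ψ f]
    with x h1 h2 h3 h4
  rw [h1, h2, h3, h4]
  ring

theorem inner_mulL2_left {φ : C(Torus, ℂ)} (hφ : ∀ x, (starRingEnd ℂ) (φ x) = φ x)
    (f g : L2Torus) : inner ℂ (mulL2 φ f) g = inner ℂ f (mulL2 φ g) := by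
  rw [L2.inner_def, L2.inner_def]
  refine integral_congr_ae ?_
  filter_upwards [mulL2_ae φ f, mulL2_ae φ g] with x h1 h2
  rw [h1, h2]
  simp only [RCLike.inner_apply, map_mul, hφ]
  ring

theorem torusCoeff_mulL2_fourier (k : ℤ) (f : L2Torus) (n : ℤ) :
    torusCoeff (mulL2 (fourier k) f) n = torusCoeff f (n - k) := by
  rw [torusCoeff, torusCoeff, fourierBasis_repr, fourierBasis_repr, fourierCoeff, fourierCoeff]
  refine integral_congr_ae ?_
  filter_upwards [mulL2_ae (fourier k) f] with x h1
  rw [h1, show -(n - k) = -n + k by ring, fourier_add, smul_eq_mul, smul_eq_mul, mul_assoc]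

/-- Multiplication by a continuous function, on Fourier coefficients. -/
noncomputable def multOp (φ : C(Torus, ℂ)) : SeqSpace →L[ℂ] SeqSpace :=
  fourierBasis.repr.toContinuousLinearEquiv.toContinuousLinearMap ∘L
    (mulL2 φ).mkContinuous ‖φ‖ (norm_mulL2_le φ) ∘L
      fourierBasis.repr.symm.toContinuousLinearEquiv.toContinuousLinearMap

theorem multOp_def (φ : C(Torus, ℂ)) (c : SeqSpace) :
    multOp φ c = fourierBasis.repr (mulL2 φ (fourierBasis.repr.symm c)) := rfl

theorem multOp_repr (φ : C(Torus, ℂ)) (f : L2Torus) :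
    multOp φ (fourierBasis.repr f) = fourierBasis.repr (mulL2 φ f) := by
  rw [multOp_def, LinearIsometryEquiv.symm_apply_apply]

theorem norm_multOp_apply_le (φ : C(Torus, ℂ)) (c : SeqSpace) : ‖multOp φ c‖ ≤ ‖φ‖ * ‖c‖ := by
  rw [multOp_def, LinearIsometryEquiv.norm_map]
  refine (norm_mulL2_le _ _).trans ?_
  rw [LinearIsometryEquiv.norm_map]

theorem norm_multOp_le (φ : C(Torus, ℂ)) : ‖multOp φ‖ ≤ ‖φ‖ :=
  ContinuousLinearMap.opNorm_le_bound _ (norm_nonneg _) (norm_multOp_apply_le φ)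

theorem multOp_add (φ ψ : C(Torus, ℂ)) (c : SeqSpace) :
    multOp (φ + ψ) c = multOp φ c + multOp ψ c := by
  simp only [multOp_def, mulL2_add, map_add]

theorem multOp_smul (a : ℂ) (φ : C(Torus, ℂ)) (c : SeqSpace) :
    multOp (a • φ) c = a • multOp φ c := by
  simp only [multOp_def, mulL2_smul, map_smul]

theorem multOp_one (c : SeqSpace) : multOp 1 c = c := by
  rw [multOp_def, mulL2_one, LinearIsometryEquiv.apply_symm_apply]

/-- With `φ` or `ψ` an exponential this says that the potential commutes with index shifts, which
makes the eigenvalues 1-periodic in `σ₁`. -/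
theorem multOp_comm (φ ψ : C(Torus, ℂ)) (c : SeqSpace) :
    multOp φ (multOp ψ c) = multOp ψ (multOp φ c) := by
  simp only [multOp_def, LinearIsometryEquiv.symm_apply_apply, mulL2_mul φ ψ]

theorem multOp_fourier_apply (k : ℤ) (c : SeqSpace) (n : ℤ) :
    multOp (fourier k) c n = c (n - k) := by
  have h := torusCoeff_mulL2_fourier k (fourierBasis.repr.symm c) n
  simp only [torusCoeff, LinearIsometryEquiv.apply_symm_apply] at h
  exact h

theorem inner_multOp_left {φ : C(Torus, ℂ)} (hφ : ∀ x, (starRingEnd ℂ) (φ x) = φ x)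
    (f g : SeqSpace) : inner ℂ (multOp φ f) g = inner ℂ f (multOp φ g) := by
  have h := inner_mulL2_left hφ (fourierBasis.repr.symm f) (fourierBasis.repr.symm g)
  rw [← fourierBasis.repr.inner_map_map, ← fourierBasis.repr.inner_map_map,
    LinearIsometryEquiv.apply_symm_apply, LinearIsometryEquiv.apply_symm_apply] at h
  exact h

theorem blochSymbol_eq (ε ω : ℝ) (σ : ℝ × ℝ) (n : ℤ) :
    blochSymbol ε ω σ n = ((-dispersion (1 + 2 * ε * ω) σ n ^ 2 : ℝ) : ℂ) := by
  have h : (Complex.I * n + Complex.I * σ.1) ^ 2 = -((n : ℂ) + σ.1) ^ 2 := by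
    rw [← mul_add, mul_pow, Complex.I_sq]; ring
  rw [blochSymbol, h, dispersion]
  push_cast
  ring

theorem torusCoeff_blochOperator (b s ε ω : ℝ) (u : C(Torus, ℝ)) (σ : ℝ × ℝ)
    (W : (blochOperator b s ε ω u σ).domain) (n : ℤ) :
    torusCoeff (blochOperator b s ε ω u σ W) n
      = ((-dispersion (1 + 2 * ε * ω) σ n ^ 2 : ℝ) : ℂ) * torusCoeff W n
        + multOp (rollPotential b s ε u) (fourierBasis.repr (W : L2Torus)) n := by
  have h : blochOperator b s ε ω u σ W
      = blochPrincipal ε ω σ W + mulL2 (rollPotential b s ε u) (W : L2Torus) := rfl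
  have h2 : torusCoeff (blochPrincipal ε ω σ W) n = blochSymbol ε ω σ n * torusCoeff W n := by
    change fourierBasis.repr (fourierBasis.repr.symm _) n = _
    rw [LinearIsometryEquiv.apply_symm_apply]
  rw [← blochSymbol_eq, ← h2, multOp_repr, h, torusCoeff, map_add]
  rfl

/-- Decay of eigensequences: a solution of the eigenvalue equation lies in `H⁴`. -/
theorem memℓp_of_coeff_eigen {κ : ℝ} (hκ : 3 / 4 ≤ κ) {V : SeqSpace →L[ℂ] SeqSpace}
    {σ : ℝ × ℝ} {μ : ℝ} {c : SeqSpace}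
    (hc : ∀ n, (μ : ℂ) * c n + (dispersion κ σ n : ℂ) ^ 2 * c n = V c n) :
    Memℓp (fun n : ℤ => ((1 + (n : ℝ) ^ 2) ^ 2 : ℝ) • c n) 2 := by
  set K := (4 + 2 * σ.1 ^ 2) with hK
  have hK0 : 0 ≤ K := by positivity
  have h1 : Memℓp (fun n => (2 * K ^ 2) * (‖c n‖ + ‖(V c - (μ : ℂ) • c : SeqSpace) n‖) : ℤ → ℝ) 2 :=
    Memℓp.const_mul ((memℓp_norm_iff.mpr (lp.memℓp c)).add
      (memℓp_norm_iff.mpr (lp.memℓp (V c - (μ : ℂ) • c)))) _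
  refine h1.mono' (F := fun _ => ℝ) fun n => ?_
  have h2 : (V c - (μ : ℂ) • c : SeqSpace) n = (dispersion κ σ n : ℂ) ^ 2 * c n := by
    change V c n - (μ : ℂ) * c n = _
    rw [← hc n]; ring
  have h5 : ‖(dispersion κ σ n : ℂ) ^ 2 * c n‖ = dispersion κ σ n ^ 2 * ‖c n‖ := by
    rw [norm_mul, norm_pow, Complex.norm_real, Real.norm_eq_abs, sq_abs]
  rw [h2, h5, norm_smul, Real.norm_of_nonneg (by positivity), Real.norm_of_nonneg (by positivity)]
  have h3 := one_add_sq_le_dispersion hκ σ n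
  have h4 : (1 + (n : ℝ) ^ 2) ^ 2 ≤ 2 * K ^ 2 * (1 + dispersion κ σ n ^ 2) := by
    calc (1 + (n : ℝ) ^ 2) ^ 2 ≤ (K * (1 + |dispersion κ σ n|)) ^ 2 := by
          gcongr
      _ ≤ _ := by
        rw [← sq_abs (dispersion κ σ n), mul_pow]
        nlinarith [mul_nonneg (sq_nonneg K) (sq_nonneg (|dispersion κ σ n| - 1))]
  nlinarith [mul_le_mul_of_nonneg_right h4 (norm_nonneg (c n))]

/-- Injectivity of `W` turns kernel vectors `g` into eigensequences `c = W g`. Conversely, an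
eigensequence decays fast enough for `W⁻¹ c` to be square summable. -/
theorem exists_pencil_iff {κ : ℝ} (hκ : 3 / 4 ≤ κ) {V : SeqSpace →L[ℂ] SeqSpace}
    {σ : ℝ × ℝ} {μ : ℝ} :
    (∃ g, g ≠ 0 ∧ pencil κ V (σ, μ) g = 0) ↔
      ∃ c : SeqSpace, c ≠ 0 ∧
        ∀ n, (μ : ℂ) * c n + (dispersion κ σ n : ℂ) ^ 2 * c n = V c n := by
  have hw : ∀ n : ℤ, (((1 + (n : ℝ) ^ 2)⁻¹ : ℝ) : ℂ) ≠ 0 := fun n => by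
    exact_mod_cast (inv_pos.mpr (one_add_sq_pos n)).ne'
  have hpen : ∀ (g : SeqSpace) n, pencil κ V (σ, μ) g n = (((1 + (n : ℝ) ^ 2)⁻¹ : ℝ) : ℂ) *
      ((μ : ℂ) * weightOp g n + (dispersion κ σ n : ℂ) ^ 2 * weightOp g n
        - V (weightOp g) n) := by
    intro g n
    have : pencil κ V (σ, μ) g n = (μ : ℂ) * weightOp (weightOp g) n
      + dispersionOp κ σ (dispersionOp κ σ g) n - weightOp (V (weightOp g)) n := rfl
    rw [this]
    simp only [dispersionOp_apply, weightOp_apply]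
    ring
  constructor
  · rintro ⟨g, hg, hg0⟩
    refine ⟨weightOp g, fun h => hg (weightOp_injective (h.trans (map_zero _).symm)), fun n => ?_⟩
    have h1 := hpen g n
    rw [hg0] at h1
    have h2 := (mul_eq_zero.mp h1.symm).resolve_left (hw n)
    linear_combination h2
  · rintro ⟨c, hc, hcn⟩
    have hmem : Memℓp (fun n : ℤ => ((1 + (n : ℝ) ^ 2 : ℝ) : ℂ) * c n) 2 := by
      refine (memℓp_of_coeff_eigen hκ hcn).mono' fun n => ?_
      rw [norm_mul, norm_smul, Complex.norm_real, norm_pow]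
      refine mul_le_mul_of_nonneg_right ?_ (norm_nonneg _)
      rw [Real.norm_of_nonneg (one_add_sq_pos n).le]
      nlinarith [sq_nonneg (n : ℝ)]
    set g : SeqSpace := ⟨_, hmem⟩ with hg
    have hgc : weightOp g = c := by
      ext n
      have : g n = ((1 + (n : ℝ) ^ 2 : ℝ) : ℂ) * c n := rfl
      rw [weightOp_apply, this, ← mul_assoc, ← Complex.ofReal_mul,
        inv_mul_cancel₀ (one_add_sq_pos n).ne', Complex.ofReal_one, one_mul]
    refine ⟨g, fun h => hc (by rw [← hgc, h, map_zero]), ?_⟩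
    ext n
    rw [hpen, hgc, hcn n, sub_self, mul_zero]
    rfl

/-- The domain condition disappears: by ellipticity an `ℓ²` solution of the coefficient equations is
automatically in `H⁴`. -/
theorem isUnstableEigenvalue_iff {b s ε ω : ℝ} (hκ : 3 / 4 ≤ 1 + 2 * ε * ω) {u : C(Torus, ℝ)}
    {σ : ℝ × ℝ} {μ : ℝ} :
    IsUnstableEigenvalue (blochOperator b s ε ω u σ) μ ↔
      0 < μ ∧ ∃ c : SeqSpace, c ≠ 0 ∧
        ∀ n, (μ : ℂ) * c n + (dispersion (1 + 2 * ε * ω) σ n : ℂ) ^ 2 * c n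
          = multOp (rollPotential b s ε u) c n := by
  refine and_congr_right fun _ => ⟨?_, ?_⟩
  · rintro ⟨W, hW, hWμ⟩
    refine ⟨fourierBasis.repr (W : L2Torus), fun h => hW (by simpa using h), fun n => ?_⟩
    have h1 := torusCoeff_blochOperator b s ε ω u σ W n
    rw [hWμ, torusCoeff, map_smul] at h1
    have h2 : (μ : ℂ) * fourierBasis.repr (W : L2Torus) n = _ := h1
    rw [h2, torusCoeff]
    push_cast
    ring
  · rintro ⟨c, hc, hcn⟩
    have hmem : fourierBasis.repr.symm c ∈ sobolevH4 := by
      have h1 := memℓp_of_coeff_eigen hκ hcn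
      change Memℓp _ 2
      simpa only [torusCoeff, LinearIsometryEquiv.apply_symm_apply] using h1
    refine ⟨⟨_, hmem⟩, fun h => hc (by simpa using h), ?_⟩
    refine fourierBasis.repr.injective ?_
    ext n
    refine (torusCoeff_blochOperator b s ε ω u σ ⟨_, hmem⟩ n).trans ?_
    rw [map_smul]
    change _ * fourierBasis.repr (fourierBasis.repr.symm c) n
      + multOp _ (fourierBasis.repr (fourierBasis.repr.symm c)) n
      = (μ : ℂ) * fourierBasis.repr (fourierBasis.repr.symm c) n
    rw [LinearIsometryEquiv.apply_symm_apply, ← hcn n]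
    push_cast
    ring

/-- Integer shifts of the Floquet exponent do not change the eigenvalues. -/
theorem coeff_eigen_shift {κ : ℝ} {φ : C(Torus, ℂ)} {σ : ℝ × ℝ} {μ : ℝ} (k : ℤ)
    (h : ∃ c : SeqSpace, c ≠ 0 ∧
        ∀ n, (μ : ℂ) * c n + (dispersion κ σ n : ℂ) ^ 2 * c n = multOp φ c n) :
    ∃ c : SeqSpace, c ≠ 0 ∧
        ∀ n, (μ : ℂ) * c n + (dispersion κ (σ.1 - k, σ.2) n : ℂ) ^ 2 * c n = multOp φ c n := by
  obtain ⟨c, hc, hcn⟩ := h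
  refine ⟨multOp (fourier k) c, fun h0 => hc ?_, fun n => ?_⟩
  · ext n
    have := congrArg (fun x : SeqSpace => x (n + k)) h0
    simpa [multOp_fourier_apply] using this
  · rw [multOp_comm, multOp_fourier_apply, multOp_fourier_apply, ← hcn (n - k)]
    have : dispersion κ (σ.1 - k, σ.2) n = dispersion κ σ (n - k) := by
      simp only [dispersion]; push_cast; ring
    rw [this]

/-- Conclusion of the instability lemma for a profile `u = 2a cos x + O(a²)`. -/
theorem exists_maximal_unstable_eigenvalue {b s ε ω a D : ℝ} (hb : b ≠ 0) (ha : a ≠ 0)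
    (hκ : 3 / 4 ≤ 1 + 2 * ε * ω) (hκ' : 1 + 2 * ε * ω ≤ 4) (hD : 0 ≤ D) {u : C(Torus, ℝ)}
    (hu : ∀ x : Torus, ‖((2 * b * u x - 3 * s * u x ^ 2 : ℝ) : ℂ)
      - (2 * a * b : ℝ) * (fourier 1 x + fourier (-1) x)‖ ≤ D * a ^ 2)
    (hsmall : (2 * (D / (4 * b ^ 2)) + 128) * |2 * a * b| < 1) :
    ∃ (lamM : ℝ) (σbar : ℝ × ℝ),
      IsUnstableEigenvalue (blochOperator b s ε ω u σbar) lamM ∧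
      (∀ (σ : ℝ × ℝ) (μ : ℝ),
        IsUnstableEigenvalue (blochOperator b s ε ω u σ) μ → μ ≤ lamM) ∧
      ∃ (N : Set (ℝ × ℝ)) (lam : ℝ × ℝ → ℝ),
        IsOpen N ∧ σbar ∈ N ∧ AnalyticOnNhd ℝ lam N ∧ lam σbar = lamM ∧
        ∀ σ ∈ N, IsUnstableEigenvalue (blochOperator b s ε ω u σ) (lam σ) := by
  set t := 2 * a * b with ht
  set φ := rollPotential b s ε u with hφ
  set φ₀ : C(Torus, ℂ) := fourier 1 + fourier (-1) with hφ₀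
  set E : C(Torus, ℂ) := φ - ((ε ^ 2 : ℝ) : ℂ) • 1 - (t : ℂ) • φ₀ with hE
  have hφE : φ = ((ε ^ 2 : ℝ) : ℂ) • 1 + (t : ℂ) • φ₀ + E := by rw [hE]; module
  have hEn : ‖E‖ ≤ D / (4 * b ^ 2) * t ^ 2 := by
    -- As `t = 2ab` with `b ≠ 0`, an error `O(a²)` in the potential is an error `O(t²)`.
    have e1 : D / (4 * b ^ 2) * t ^ 2 = D * a ^ 2 := by rw [ht]; field_simp; norm_num
    rw [e1, ContinuousMap.norm_le _ (by positivity)]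
    intro x
    refine le_trans (le_of_eq ?_) (hu x)
    congr 1
    simp only [hE, hφ, hφ₀, rollPotential, ContinuousMap.sub_apply, ContinuousMap.smul_apply,
      ContinuousMap.add_apply, ContinuousMap.one_apply, ContinuousMap.coe_mk, smul_eq_mul]
    push_cast
    ring
  have hV : ∀ f g, inner ℂ (multOp φ f) g = inner ℂ f (multOp φ g) :=
    inner_multOp_left fun x => Complex.conj_ofReal _
  have hV₀ : ∀ (c : SeqSpace) n, multOp φ₀ c n = c (n - 1) + c (n + 1) := by
    intro c n
    rw [hφ₀, multOp_add]
    change multOp (fourier 1) c n + multOp (fourier (-1)) c n = _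
    rw [multOp_fourier_apply, multOp_fourier_apply, sub_neg_eq_add]
  have hV₀n : ‖multOp φ₀‖ ≤ 2 := by
    refine (norm_multOp_le _).trans ((norm_add_le _ _).trans ?_)
    rw [fourier_norm, fourier_norm]
    norm_num
  have hVq : ∀ c, |(inner ℂ (multOp φ c) c).re - ε ^ 2 * ‖c‖ ^ 2
      - t * (inner ℂ (multOp φ₀ c) c).re| ≤ D / (4 * b ^ 2) * t ^ 2 * ‖c‖ ^ 2 := by
    intro c
    have e1 : (inner ℂ (multOp φ c) c).re - ε ^ 2 * ‖c‖ ^ 2 - t * (inner ℂ (multOp φ₀ c) c).re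
        = (inner ℂ (multOp E c) c).re := by
      rw [hφE, multOp_add, multOp_add, multOp_smul, multOp_smul, multOp_one, inner_add_left,
        inner_add_left, inner_smul_left, inner_smul_left, Complex.conj_ofReal,
        Complex.conj_ofReal, inner_self_eq_ofReal_norm_sq, Complex.add_re, Complex.add_re,
        Complex.re_ofReal_mul, Complex.re_ofReal_mul, Complex.ofReal_re]
      ring
    rw [e1]
    calc |(inner ℂ (multOp E c) c).re| ≤ ‖inner ℂ (multOp E c) c‖ := Complex.abs_re_le_norm _
      _ ≤ ‖multOp E c‖ * ‖c‖ := norm_inner_le_norm _ _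
      _ ≤ (D / (4 * b ^ 2) * t ^ 2 * ‖c‖) * ‖c‖ := by
        gcongr
        exact (norm_multOp_apply_le E c).trans (by gcongr)
      _ = _ := by ring
  obtain ⟨lam₀, σ₀, hpos, hex, hmax, N, lam, hN, hσN, han, hlam0, hlam⟩ :=
    exists_maximal_eigenvalue hκ hκ' (sq_nonneg ε) (by positivity)
      (by rw [ht]; positivity) hsmall hV hV₀ hV₀n hVq
  refine ⟨lam₀, σ₀, ?_, fun σ μ hμ => ?_, N, lam, hN, hσN, han, hlam0, fun σ hσ => ?_⟩
  · exact (isUnstableEigenvalue_iff hκ).mpr ⟨hpos, (exists_pencil_iff hκ).mp hex⟩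
  -- Maximality is known only for `σ₁ ∈ [0, 1]`; an integer shift brings any exponent there.
  · refine hmax (σ.1 - ⌊σ.1⌋, σ.2) μ ?_ ?_
    · exact ⟨by linarith [Int.floor_le σ.1], by linarith [Int.lt_floor_add_one σ.1]⟩
    · exact (exists_pencil_iff hκ).mpr
        (coeff_eigen_shift ⌊σ.1⌋ ((isUnstableEigenvalue_iff hκ).mp hμ).2)
  · exact (isUnstableEigenvalue_iff hκ).mpr
      ⟨(hlam σ hσ).1, (exists_pencil_iff hκ).mp (hlam σ hσ).2⟩

/-! ### Cosine coefficients and cosine series of even functions. -/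

/-- The function `x ↦ cos (n x)` on the torus. -/
noncomputable def cosFun (n : ℤ) : C(Torus, ℝ) := ⟨fun x => (fourier n x).re, by fun_prop⟩

@[simp] theorem cosFun_coe (n : ℤ) (x : ℝ) : cosFun n (x : Torus) = Real.cos (n * x) := by
  change (fourier n (x : Torus)).re = _
  rw [fourier_coe_apply]
  have : 2 * (π : ℂ) * Complex.I * n * x / ((2 * π : ℝ) : ℂ) = ((n * x : ℝ) : ℂ) * Complex.I := by
    have : (π : ℂ) ≠ 0 := by exact_mod_cast Real.pi_ne_zero
    push_cast
    field_simp
  rw [this, Complex.exp_ofReal_mul_I_re]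

theorem ofReal_cosFun (n : ℤ) (x : Torus) :
    (cosFun n x : ℂ) = (fourier n x + fourier (-n) x) / 2 := by
  rw [fourier_neg, Complex.add_conj]
  change (((fourier n x).re : ℝ) : ℂ) = _
  push_cast
  ring

theorem cosFun_neg (n : ℤ) : cosFun (-n) = cosFun n := by
  ext x
  induction x using QuotientAddGroup.induction_on with
  | H x => rw [cosFun_coe, cosFun_coe]; push_cast; rw [neg_mul, Real.cos_neg]

theorem cosFun_apply_neg (n : ℤ) (x : Torus) : cosFun n (-x) = cosFun n x := by
  induction x using QuotientAddGroup.induction_on with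
  | H x =>
    rw [← AddCircle.coe_neg, cosFun_coe, cosFun_coe, mul_neg, Real.cos_neg]

theorem norm_cosFun_le (n : ℤ) : ‖cosFun n‖ ≤ 1 := by
  rw [ContinuousMap.norm_le _ zero_le_one]
  intro x
  induction x using QuotientAddGroup.induction_on with
  | H x => rw [cosFun_coe]; exact Real.abs_cos_le_one _

theorem cosFun_one_mul (n : ℤ) :
    cosFun 1 * cosFun n = (1 / 2 : ℝ) • (cosFun (n - 1) + cosFun (n + 1)) := by
  ext x
  induction x using QuotientAddGroup.induction_on with
  | H x =>
    simp only [ContinuousMap.mul_apply, ContinuousMap.smul_apply, ContinuousMap.add_apply,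
      cosFun_coe, smul_eq_mul]
    push_cast
    rw [sub_mul, add_mul, one_mul, Real.cos_sub, Real.cos_add]
    ring

theorem integrable_torus {F : Type*} [NormedAddCommGroup F] (f : C(Torus, F)) :
    Integrable f (AddCircle.haarAddCircle (T := 2 * π)) :=
  (map_continuous f).integrable_of_hasCompactSupport (.of_compactSpace _)

/-- The cosine coefficients `∫ f cos (n ·)` of a continuous real function on the torus. -/
noncomputable def cosCoeff (n : ℤ) : C(Torus, ℝ) →L[ℝ] ℝ :=
  LinearMap.mkContinuous
    { toFun := fun f => ∫ x, f x * cosFun n x ∂(AddCircle.haarAddCircle (T := 2 * π))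
      map_add' := fun f g => by
        have h := integral_add (integrable_torus (f * cosFun n)) (integrable_torus (g * cosFun n))
        simp only [ContinuousMap.mul_apply] at h
        simp only [ContinuousMap.add_apply, add_mul, h]
      map_smul' := fun c f => by
        simp only [ContinuousMap.smul_apply, smul_eq_mul, mul_assoc, integral_const_mul,
          RingHom.id_apply] } 1 (fun f => by
      refine (norm_integral_le_of_norm_le_const (C := 1 * ‖f‖) (.of_forall fun x => ?_)).trans ?_
      · change ‖(f * cosFun n) x‖ ≤ _
        refine (ContinuousMap.norm_coe_le_norm _ x).trans ((norm_mul_le _ _).trans ?_)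
        rw [mul_comm]
        gcongr
        exact norm_cosFun_le n
      · simp)

theorem cosCoeff_apply (n : ℤ) (f : C(Torus, ℝ)) :
    cosCoeff n f = ∫ x, f x * cosFun n x ∂(AddCircle.haarAddCircle (T := 2 * π)) := rfl

theorem abs_cosCoeff_le (n : ℤ) (f : C(Torus, ℝ)) : |cosCoeff n f| ≤ ‖f‖ := by
  have h : |cosCoeff n f| ≤ 1 * ‖f‖ := ContinuousLinearMap.le_of_opNorm_le _
    (LinearMap.mkContinuous_norm_le _ zero_le_one _ : ‖cosCoeff n‖ ≤ 1) f
  rwa [one_mul] at h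

theorem cosCoeff_neg (n : ℤ) (f : C(Torus, ℝ)) : cosCoeff (-n) f = cosCoeff n f := by
  rw [cosCoeff_apply, cosFun_neg, cosCoeff_apply]

theorem cosCoeff_cosFun_one_mul (n : ℤ) (f : C(Torus, ℝ)) :
    cosCoeff n (cosFun 1 * f) = (1 / 2) * (cosCoeff (n - 1) f + cosCoeff (n + 1) f) := by
  simp only [cosCoeff_apply]
  have h := integral_add (integrable_torus (f * cosFun (n - 1)))
    (integrable_torus (f * cosFun (n + 1)))
  simp only [ContinuousMap.mul_apply] at h
  rw [← h, ← integral_const_mul]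
  congr 1
  funext x
  have := congrArg (fun g : C(Torus, ℝ) => g x) (cosFun_one_mul n)
  simp only [ContinuousMap.mul_apply, ContinuousMap.smul_apply, ContinuousMap.add_apply,
    smul_eq_mul] at this ⊢
  linear_combination f x * this

/-- The Fourier coefficients of an even real function are its cosine coefficients. -/
theorem fourierCoeff_ofReal_of_even {f : C(Torus, ℝ)} (hf : ∀ x, f (-x) = f x) (n : ℤ) :
    fourierCoeff (fun x => (f x : ℂ)) n = (cosCoeff n f : ℂ) := by
  have h1 : fourierCoeff (fun x => (f x : ℂ)) n
      = ∫ x, fourier n x * (f x : ℂ) ∂(AddCircle.haarAddCircle (T := 2 * π)) := by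
    rw [fourierCoeff, ← integral_neg_eq_self]
    congr 1
    funext x
    rw [hf, smul_eq_mul, fourier_apply, fourier_apply, neg_smul_neg]
  have hc : Continuous fun x : Torus => (f x : ℂ) := by fun_prop
  have h2 : (2 : ℂ) * fourierCoeff (fun x => (f x : ℂ)) n = 2 * (cosCoeff n f : ℂ) := by
    rw [two_mul]
    nth_rewrite 1 [h1]
    have h := integral_add (integrable_torus ⟨_, (map_continuous (fourier n)).mul hc⟩)
      (integrable_torus ⟨_, (map_continuous (fourier (-n))).mul hc⟩)
    simp only [ContinuousMap.coe_mk, Pi.mul_apply] at h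
    rw [fourierCoeff, cosCoeff_apply, ← integral_complex_ofReal, ← integral_const_mul]
    simp only [smul_eq_mul]
    rw [← h]
    congr 1
    funext x
    rw [Complex.ofReal_mul, ofReal_cosFun]
    ring
  exact mul_left_cancel₀ two_ne_zero h2

/-- An even continuous function is determined by its cosine coefficients. -/
theorem eq_of_cosCoeff_eq {f g : C(Torus, ℝ)} (hf : ∀ x, f (-x) = f x) (hg : ∀ x, g (-x) = g x)
    (h : ∀ n, cosCoeff n f = cosCoeff n g) : f = g := by
  let F : C(Torus, ℝ) → C(Torus, ℂ) := fun f => ⟨fun x => (f x : ℂ), by fun_prop⟩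
  have h1 : ContinuousMap.toLp (E := ℂ) 2 AddCircle.haarAddCircle ℂ (F f)
      = ContinuousMap.toLp (E := ℂ) 2 AddCircle.haarAddCircle ℂ (F g) := by
    refine fourierBasis.repr.injective ?_
    ext n
    rw [fourierBasis_repr, fourierBasis_repr, fourierCoeff_toLp, fourierCoeff_toLp]
    change fourierCoeff (fun x => (f x : ℂ)) n = fourierCoeff (fun x => (g x : ℂ)) n
    rw [fourierCoeff_ofReal_of_even hf, fourierCoeff_ofReal_of_even hg, h]
  have h2 := ContinuousMap.toLp_injective (𝕜 := ℂ) AddCircle.haarAddCircle h1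
  ext x
  have := congrArg (fun φ : C(Torus, ℂ) => φ x) h2
  exact Complex.ofReal_injective this

theorem cosCoeff_cosFun (k n : ℤ) :
    cosCoeff k (cosFun n) = ((if k = n then 1 else 0) + (if k = -n then 1 else 0)) / 2 := by
  have h1 := fourierCoeff_ofReal_of_even (cosFun_apply_neg n) k
  have h2 : (fun x => (cosFun n x : ℂ))
      = (2⁻¹ : ℂ) • ((fourier n : Torus → ℂ) + (fourier (-n) : Torus → ℂ)) := by
    funext x
    rw [ofReal_cosFun]
    simp only [Pi.smul_apply, Pi.add_apply, smul_eq_mul]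
    ring
  rw [h2, fourierCoeff.const_smul, fourierCoeff.add (integrable_torus _) (integrable_torus _),
    Pi.add_apply, fourierCoeff_fourier, fourierCoeff_fourier, Pi.single_apply, Pi.single_apply] at h1
  have h3 : (((((if k = n then 1 else 0) + (if k = -n then 1 else 0)) / 2 : ℝ)) : ℂ)
      = (cosCoeff k (cosFun n) : ℂ) := by
    rw [← h1, smul_eq_mul]
    split_ifs <;> norm_num
  exact_mod_cast h3.symm

/-- The cosine series with coefficients `c n`. -/
noncomputable def cosSeries (c : ℤ → ℝ) : C(Torus, ℝ) := ∑' n, c n • cosFun n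

section CosSeries

variable {c d : ℤ → ℝ}

theorem norm_smul_cosFun_le (n : ℤ) : ‖c n • cosFun n‖ ≤ |c n| := by
  rw [norm_smul, Real.norm_eq_abs]
  exact mul_le_of_le_one_right (abs_nonneg _) (norm_cosFun_le n)

theorem hasSum_cosSeries (hc : Summable c) : HasSum (fun n => c n • cosFun n) (cosSeries c) :=
  (Summable.of_norm_bounded hc.abs norm_smul_cosFun_le).hasSum

theorem norm_cosSeries_le (hd : Summable d) (h : ∀ n, |c n| ≤ d n) :
    ‖cosSeries c‖ ≤ ∑' n, d n :=
  tsum_of_norm_bounded hd.hasSum fun n => (norm_smul_cosFun_le n).trans (h n)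

theorem cosCoeff_cosSeries (hc : Summable c) (hneg : ∀ n, c (-n) = c n) (k : ℤ) :
    cosCoeff k (cosSeries c) = c k := by
  have h1 := (cosCoeff k).hasSum (hasSum_cosSeries hc)
  -- The series runs over all of `ℤ`, so mode `k` is met at `n = k` and at `n = -k`, each with
  -- weight `1/2`; for `k = 0` the two halves come from the same term.
  have h2 : HasSum (fun n => c n * ((if k = n then 1 else 0) / 2)) (c k / 2) := by
    convert! hasSum_ite_eq k (c k / 2) using 2 with n
    by_cases h : n = k
    · subst h; simp; ring
    · simp [h, Ne.symm h]
  have h3 : HasSum (fun n => c n * ((if k = -n then 1 else 0) / 2)) (c k / 2) := by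
    convert! hasSum_ite_eq (-k) (c k / 2) using 2 with n
    by_cases h : n = -k
    · subst h; simp [hneg]; ring
    · have : k ≠ -n := by omega
      simp [h, this]
  refine h1.unique ?_
  have h4 := h2.add h3
  rw [add_halves] at h4
  refine h4.congr_fun fun n => ?_
  simp only [map_smul, smul_eq_mul, cosCoeff_cosFun]
  ring

theorem cosSeries_apply (hc : Summable c) (x : Torus) :
    HasSum (fun n => c n * cosFun n x) (cosSeries c x) :=
  (ContinuousMap.evalCLM ℝ x).hasSum (hasSum_cosSeries hc)

theorem cosSeries_apply_neg (hc : Summable c) (x : Torus) :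
    cosSeries c (-x) = cosSeries c x := by
  refine (cosSeries_apply hc (-x)).unique ?_
  simpa only [cosFun_apply_neg] using cosSeries_apply hc x

theorem abs_iteratedDeriv_cos_le (k : ℕ) (x : ℝ) :
    |iteratedDeriv k Real.cos x| ≤ 1 ∧ |iteratedDeriv k Real.sin x| ≤ 1 := by
  induction k generalizing x with
  | zero => simpa using ⟨Real.abs_cos_le_one x, Real.abs_sin_le_one x⟩
  | succ k ih => simpa using ⟨(ih x).2, (ih x).1⟩

/-- Termwise differentiability of a cosine series. -/
theorem contDiff_cosSeries {N : ℕ} (hc : Summable c)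
    (hN : ∀ k ≤ N, Summable fun n : ℤ => |c n| * |(n : ℝ)| ^ k) :
    ContDiff ℝ N fun x : ℝ => cosSeries c (x : Torus) := by
  have h1 : (fun x : ℝ => cosSeries c (x : Torus)) = fun x => ∑' n : ℤ, c n * Real.cos (n * x) := by
    funext x
    rw [← (cosSeries_apply hc (x : Torus)).tsum_eq]
    simp only [cosFun_coe]
  rw [h1]
  have h2 : ContDiff ℝ ((N : ℕ∞) : WithTop ℕ∞) fun x => ∑' n : ℤ, c n * Real.cos (n * x) := by
    refine contDiff_tsum (v := fun k (n : ℤ) => |c n| * |(n : ℝ)| ^ k) (fun n => by fun_prop)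
      (fun k hk => hN k (by exact_mod_cast hk)) fun k n x _ => ?_
    rw [norm_iteratedFDeriv_eq_norm_iteratedDeriv,
      iteratedDeriv_const_mul_field,
      iteratedDeriv_comp_const_mul (Real.contDiff_cos.of_le le_top), Real.norm_eq_abs, abs_mul,
      abs_mul, abs_pow]
    gcongr
    exact mul_le_of_le_one_right (by positivity) (abs_iteratedDeriv_cos_le k _).1
  exact h2

end CosSeries

/-! ### Derivatives, regularity and the roll equation in cosine coefficients. -/

theorem cosCoeff_eq_intervalIntegral (n : ℤ) (f : C(Torus, ℝ)) :
    cosCoeff n f = (2 * π)⁻¹ * ∫ x in (0 : ℝ)..2 * π, f (x : Torus) * Real.cos (n * x) := by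
  rw [cosCoeff_apply, AddCircle.integral_haarAddCircle, smul_eq_mul]
  congr 1
  have h := AddCircle.intervalIntegral_preimage (2 * π) 0 fun x => f x * cosFun n x
  rw [zero_add] at h
  rw [← h]
  simp only [cosFun_coe]

theorem coe_add_two_pi (x : ℝ) : ((x + 2 * π : ℝ) : Torus) = (x : Torus) :=
  AddCircle.coe_add_period (2 * π) x

/-- Cosine coefficients of a second derivative. -/
theorem cosCoeff_of_iteratedDeriv_two {f h : C(Torus, ℝ)}
    (hf : ContDiff ℝ 2 fun x : ℝ => f (x : Torus))
    (hh : ∀ x : ℝ, iteratedDeriv 2 (fun x : ℝ => f (x : Torus)) x = h (x : Torus)) (n : ℤ) :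
    cosCoeff n h = -(n : ℝ) ^ 2 * cosCoeff n f := by
  set F : ℝ → ℝ := fun x => f (x : Torus) with hF
  have hd1 : ∀ x, HasDerivAt F (deriv F x) x := fun x =>
    ((hf.differentiable (by norm_num)) x).hasDerivAt
  have hd2 : ∀ x : ℝ, HasDerivAt (deriv F) (h (x : Torus)) x := fun x => by
    have h1 : ContDiff ℝ 1 (deriv F) := by
      have : ContDiff ℝ (1 + 1) F := hf
      exact (contDiff_succ_iff_deriv.mp this).2.2
    have h2 := ((h1.differentiable one_ne_zero) x).hasDerivAt
    rw [← hh x, iteratedDeriv_succ, iteratedDeriv_one]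
    exact h2
  have hper : deriv F (2 * π) = deriv F 0 := by
    have h1 : (fun x => F (x + 2 * π)) = F := by
      funext x
      simp only [hF, coe_add_two_pi]
    have h2 := deriv_comp_add_const F (2 * π) 0
    rw [h1, zero_add] at h2
    exact h2.symm
  have hperF : F (2 * π) = F 0 := by
    have := coe_add_two_pi 0
    rw [zero_add] at this
    simp only [hF, this]
  have hcosd : ∀ x : ℝ, HasDerivAt (fun x => Real.cos (n * x)) (-Real.sin (n * x) * n) x := fun x =>
    (Real.hasDerivAt_cos _).comp x (by simpa using (hasDerivAt_id x).const_mul (n : ℝ))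
  have hsind : ∀ x : ℝ, HasDerivAt (fun x => Real.sin (n * x)) (Real.cos (n * x) * n) x := fun x =>
    (Real.hasDerivAt_sin _).comp x (by simpa using (hasDerivAt_id x).const_mul (n : ℝ))
  -- This primitive packages two integrations by parts; it takes equal values at `0` and `2π`, so
  -- the integral vanishes.
  have hprim : ∀ x : ℝ, HasDerivAt
      (fun x => Real.cos (n * x) * deriv F x + n * (Real.sin (n * x) * F x))
      (h (x : Torus) * Real.cos (n * x) + (n : ℝ) ^ 2 * (f (x : Torus) * Real.cos (n * x))) x := by
    intro x
    refine (((hcosd x).mul (hd2 x)).add (((hsind x).mul (hd1 x)).const_mul (n : ℝ))).congr_deriv ?_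
    simp only [hF]
    ring
  have hi1 : IntervalIntegrable (fun x : ℝ => h (x : Torus) * Real.cos (n * x)) volume 0 (2 * π) :=
    Continuous.intervalIntegrable (by fun_prop) _ _
  have hi2 : IntervalIntegrable (fun x : ℝ => f (x : Torus) * Real.cos (n * x)) volume 0 (2 * π) :=
    Continuous.intervalIntegrable (by fun_prop) _ _
  have hint := intervalIntegral.integral_eq_sub_of_hasDerivAt (fun x _ => hprim x)
    (hi1.add (hi2.const_mul ((n : ℝ) ^ 2)))
  rw [intervalIntegral.integral_add hi1 (hi2.const_mul _), intervalIntegral.integral_const_mul]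
    at hint
  rw [cosCoeff_eq_intervalIntegral, cosCoeff_eq_intervalIntegral]
  have hs : Real.sin (n * (2 * π)) = 0 := by
    have := Real.sin_int_mul_pi (2 * n)
    push_cast at this
    rwa [show (n : ℝ) * (2 * π) = 2 * n * π by ring]
  rw [hper, hperF, hs, Real.cos_int_mul_two_pi] at hint
  simp only [mul_zero, Real.cos_zero, Real.sin_zero, sub_self, zero_mul, add_zero] at hint
  linear_combination (2 * π)⁻¹ * hint

/-- The Helmholtz operator acts on smooth functions on the torus, diagonally on coefficients. -/
theorem exists_helmholtz (κ : ℝ) {k : ℕ} {f : C(Torus, ℝ)}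
    (hf : ContDiff ℝ (k + 2 : ℕ) fun x : ℝ => f (x : Torus)) :
    ∃ v : C(Torus, ℝ), (fun x : ℝ => v (x : Torus)) = helmholtzOp κ (fun x : ℝ => f (x : Torus)) ∧
      ContDiff ℝ k (fun x : ℝ => v (x : Torus)) ∧
      ((∀ x, f (-x) = f x) → ∀ x, v (-x) = v x) ∧
      ∀ n, cosCoeff n v = (1 - κ * (n : ℝ) ^ 2) * cosCoeff n f := by
  set F : ℝ → ℝ := fun x => f (x : Torus) with hF
  have hF2 : ContDiff ℝ k (iteratedDeriv 2 F) := by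
    rw [iteratedDeriv_eq_iterate]
    exact hf.iterate_deriv' k 2
  have hper : Function.Periodic (iteratedDeriv 2 F) (2 * π) := by
    intro x
    have h1 : (fun x => F (x + 2 * π)) = F := by
      funext x
      simp only [hF, coe_add_two_pi]
    have h2 := congrFun (iteratedDeriv_comp_add_const 2 F (2 * π)) x
    rw [h1] at h2
    exact h2.symm
  set h : C(Torus, ℝ) := ⟨hper.lift, continuous_coinduced_dom.mpr hF2.continuous⟩ with hh
  have hhx : ∀ x : ℝ, iteratedDeriv 2 F x = h (x : Torus) := fun x => rfl
  have hv : (fun x : ℝ => (f + κ • h) (x : Torus)) = helmholtzOp κ F := by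
    funext x
    rw [helmholtzOp, hhx]
    rfl
  have hf2 : ContDiff ℝ 2 F := hf.of_le (by norm_cast; omega)
  refine ⟨f + κ • h, hv, ?_, fun heven x => ?_, fun n => ?_⟩
  · rw [hv]
    exact (hf.of_le (by norm_cast; omega)).add (hF2.const_smul κ)
  · have h1 : ∀ x, h (-x) = h x := by
      intro x
      induction x using QuotientAddGroup.induction_on with
      | H x =>
        rw [← AddCircle.coe_neg, ← hhx, ← hhx]
        have h2 : (fun x => F (-x)) = F := by
          funext x
          simp only [hF, AddCircle.coe_neg, heven]
        have h3 := iteratedDeriv_comp_neg 2 F x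
        rw [h2] at h3
        simpa using h3.symm
    simp only [ContinuousMap.add_apply, ContinuousMap.smul_apply, heven, h1]
  · rw [map_add, map_smul, smul_eq_mul, cosCoeff_of_iteratedDeriv_two hf2 hhx]
    ring

/-- The nonlinearity `b u² - s u³`. -/
noncomputable def rollNonlinearity (b s : ℝ) (u : C(Torus, ℝ)) : C(Torus, ℝ) :=
  b • u ^ 2 - s • u ^ 3

theorem rollNonlinearity_apply (b s : ℝ) (u : C(Torus, ℝ)) (x : Torus) :
    rollNonlinearity b s u x = b * u x ^ 2 - s * u x ^ 3 := rfl

theorem even_rollNonlinearity {b s : ℝ} {u : C(Torus, ℝ)} (hu : ∀ x, u (-x) = u x) (x : Torus) :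
    rollNonlinearity b s u (-x) = rollNonlinearity b s u x := by
  simp only [rollNonlinearity_apply, hu]

/-- For classical solutions, the roll equation is equivalent to its cosine coefficients. -/
theorem stationary_iff_cosCoeff {b s ε ω : ℝ} {u : C(Torus, ℝ)}
    (hu : ContDiff ℝ 4 fun x : ℝ => u (x : Torus)) (heven : ∀ x, u (-x) = u x) :
    (∀ x : ℝ, -helmholtzOp (1 + 2 * ε * ω)
        (helmholtzOp (1 + 2 * ε * ω) (fun y : ℝ => u (y : Torus))) x
      + ε ^ 2 * u (x : Torus) + b * u (x : Torus) ^ 2 - s * u (x : Torus) ^ 3 = 0) ↔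
    ∀ n : ℤ, ((1 - (1 + 2 * ε * ω) * (n : ℝ) ^ 2) ^ 2 - ε ^ 2) * cosCoeff n u
      = cosCoeff n (rollNonlinearity b s u) := by
  set κ := 1 + 2 * ε * ω
  obtain ⟨v, hv, hvd, hve, hvc⟩ := exists_helmholtz κ (k := 2) hu
  obtain ⟨w, hw, -, hwe, hwc⟩ := exists_helmholtz κ (k := 0) (f := v) (by simpa using hvd)
  have hfun : (∀ x : ℝ, -helmholtzOp κ (helmholtzOp κ (fun y : ℝ => u (y : Torus))) x
      + ε ^ 2 * u (x : Torus) + b * u (x : Torus) ^ 2 - s * u (x : Torus) ^ 3 = 0) ↔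
      w - ε ^ 2 • u = rollNonlinearity b s u := by
    rw [← hv, ← hw]
    constructor
    · intro h
      ext x
      induction x using QuotientAddGroup.induction_on with
      | H x =>
        have := h x
        rw [rollNonlinearity_apply, ContinuousMap.sub_apply, ContinuousMap.smul_apply, smul_eq_mul]
        linarith
    · intro h x
      have := congrArg (fun g : C(Torus, ℝ) => g (x : Torus)) h
      simp only [rollNonlinearity_apply, ContinuousMap.sub_apply, ContinuousMap.smul_apply,
        smul_eq_mul] at this
      linarith
  have hcoef : ∀ n, cosCoeff n (w - ε ^ 2 • u)
      = ((1 - κ * (n : ℝ) ^ 2) ^ 2 - ε ^ 2) * cosCoeff n u := by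
    intro n
    rw [map_sub, map_smul, hwc, hvc, smul_eq_mul]
    ring
  rw [hfun]
  constructor
  · intro h n
    rw [← hcoef, h]
  · intro h
    refine eq_of_cosCoeff_eq (fun x => ?_) (even_rollNonlinearity heven) fun n => by rw [hcoef, h]
    rw [ContinuousMap.sub_apply, ContinuousMap.smul_apply, ContinuousMap.sub_apply,
      ContinuousMap.smul_apply, hwe (hve heven), heven]

/-- Decay of the cosine coefficients of a `C²` function. -/
theorem abs_cosCoeff_le_of_contDiff {f : C(Torus, ℝ)}
    (hf : ContDiff ℝ 2 fun x : ℝ => f (x : Torus)) :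
    ∃ C : ℝ, 0 ≤ C ∧ ∀ n : ℤ, |cosCoeff n f| ≤ C * (1 + (n : ℝ) ^ 2)⁻¹ := by
  -- The value `κ = -1` gives the multiplier `1 + n²`.
  obtain ⟨v, -, -, -, hv⟩ := exists_helmholtz (-1) (k := 0) (f := f) (by simpa using hf)
  refine ⟨‖v‖, norm_nonneg v, fun n => ?_⟩
  have h1 := abs_cosCoeff_le n v
  have h0 := one_add_sq_pos n
  rw [hv, abs_mul, show 1 - -1 * (n : ℝ) ^ 2 = 1 + (n : ℝ) ^ 2 by ring, abs_of_pos h0] at h1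
  rw [← div_eq_mul_inv, le_div_iff₀ h0]
  linarith

/-- An even function whose coefficients decay like `n⁻²⁽ᵏ⁺¹⁾` is `C²ᵏ`. -/
theorem contDiff_of_abs_cosCoeff_le {f : C(Torus, ℝ)} (hf : ∀ x, f (-x) = f x) {k : ℕ} {C : ℝ}
    (hC : ∀ n : ℤ, |cosCoeff n f| ≤ C * ((1 + (n : ℝ) ^ 2)⁻¹) ^ (k + 1)) :
    ContDiff ℝ (2 * k : ℕ) fun x : ℝ => f (x : Torus) := by
  have hN : ∀ j ≤ 2 * k, Summable fun n : ℤ => |cosCoeff n f| * |(n : ℝ)| ^ j := by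
    intro j hj
    refine (summable_inv_one_add_sq.mul_left C).of_nonneg_of_le (fun n => by positivity)
      fun n => ?_
    have h0 := one_add_sq_pos n
    have hC0 : 0 ≤ C * ((1 + (n : ℝ) ^ 2)⁻¹) ^ (k + 1) := (abs_nonneg _).trans (hC n)
    -- Derivatives up to order `2k` cost `k` of the `k + 1` factors and leave the summable `(1 +
    -- n²)⁻¹`.
    have h1 : |(n : ℝ)| ^ j ≤ (1 + (n : ℝ) ^ 2) ^ k := by
      have h2 : |(n : ℝ)| ≤ √(1 + (n : ℝ) ^ 2) :=
        Real.abs_le_sqrt (by linarith)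
      have h3 : 1 ≤ √(1 + (n : ℝ) ^ 2) := Real.one_le_sqrt.mpr (by nlinarith [sq_nonneg (n : ℝ)])
      calc |(n : ℝ)| ^ j ≤ √(1 + (n : ℝ) ^ 2) ^ j := by gcongr
        _ ≤ √(1 + (n : ℝ) ^ 2) ^ (2 * k) := pow_le_pow_right₀ h3 hj
        _ = _ := by rw [pow_mul, Real.sq_sqrt h0.le]
    calc |cosCoeff n f| * |(n : ℝ)| ^ j
        ≤ (C * ((1 + (n : ℝ) ^ 2)⁻¹) ^ (k + 1)) * (1 + (n : ℝ) ^ 2) ^ k :=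
          mul_le_mul (hC n) h1 (by positivity) hC0
      _ = C * (1 + (n : ℝ) ^ 2)⁻¹ := by
        rw [pow_succ, inv_pow]
        field_simp
  have hs : Summable fun n => cosCoeff n f := by
    have := hN 0 (Nat.zero_le _)
    simp only [pow_zero, mul_one] at this
    exact this.of_abs
  have hfs : f = cosSeries fun n => cosCoeff n f := by
    refine eq_of_cosCoeff_eq hf (cosSeries_apply_neg hs) fun n => ?_
    rw [cosCoeff_cosSeries hs fun n => cosCoeff_neg n f]
  rw [hfs]
  exact contDiff_cosSeries hs hN

/-! ### Lyapunov–Schmidt reduction off the modes `±1`. -/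

/-- The multiplier inverting `(1 + κ ∂ₓ²)² - ε²` off the critical modes `n = ±1`. -/
noncomputable def rollMultiplier (κ ε : ℝ) (n : ℤ) : ℝ :=
  if n = 1 ∨ n = -1 then 0 else ((1 - κ * (n : ℝ) ^ 2) ^ 2 - ε ^ 2)⁻¹

/-- For `κ` near `1` the symbol degenerates only near `n = ±1`: if `n² ≥ 4` then `κ n² - 1 ≥ n² /
2`, and at `n = 0` the value is `1 - ε²`. The bound is uniform in `κ` and `ε`, so one constant
`rollBound` serves all parameters. -/
theorem rollSymbol_ge {κ ε : ℝ} (hε : 0 ≤ ε) (hε' : ε ≤ 1 / 4) (hκ : |κ - 1| ≤ ε) {n : ℤ}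
    (hn : ¬(n = 1 ∨ n = -1)) :
    (1 + (n : ℝ) ^ 2) ^ 2 / 16 ≤ (1 - κ * (n : ℝ) ^ 2) ^ 2 - ε ^ 2 := by
  have hε2 : ε ^ 2 ≤ 1 / 16 := by nlinarith
  have hκ1 : 3 / 4 ≤ κ := by linarith [(abs_le.mp hκ).1]
  by_cases h0 : n = 0
  · subst h0
    norm_num
    linarith
  · have h4 : (4 : ℝ) ≤ (n : ℝ) ^ 2 := by
      have : 4 ≤ n ^ 2 := by
        push Not at hn
        rcases lt_or_gt_of_ne h0 with h | h
        · have : n ≤ -2 := by omega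
          nlinarith
        · have : 2 ≤ n := by omega
          nlinarith
      exact_mod_cast this
    set x : ℝ := (n : ℝ) ^ 2
    have h5 : x / 2 ≤ κ * x - 1 := by nlinarith
    have h6 : (x / 2) ^ 2 ≤ (1 - κ * x) ^ 2 := by
      rw [← neg_sq (1 - κ * x)]
      exact pow_le_pow_left₀ (by linarith) (by linarith) 2
    nlinarith

theorem abs_rollMultiplier_le {κ ε : ℝ} (hε : 0 ≤ ε) (hε' : ε ≤ 1 / 4) (hκ : |κ - 1| ≤ ε) (n : ℤ) :
    |rollMultiplier κ ε n| ≤ 16 * ((1 + (n : ℝ) ^ 2)⁻¹) ^ 2 := by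
  have h0 := one_add_sq_pos n
  rw [rollMultiplier]
  split_ifs with h
  · rw [abs_zero]; positivity
  · have h1 := rollSymbol_ge hε hε' hκ h
    have h2 : 0 < (1 + (n : ℝ) ^ 2) ^ 2 / 16 := by positivity
    rw [abs_of_pos (inv_pos.mpr (h2.trans_le h1))]
    refine (inv_anti₀ h2 h1).trans (le_of_eq ?_)
    field_simp

theorem rollMultiplier_neg (κ ε : ℝ) (n : ℤ) : rollMultiplier κ ε (-n) = rollMultiplier κ ε n := by
  have : (-n = 1 ∨ -n = -1) ↔ (n = 1 ∨ n = -1) := by omega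
  simp only [rollMultiplier, this, Int.cast_neg, neg_sq]

/-- A uniform bound for the solution operators off the critical modes. -/
noncomputable def rollBound : ℝ := ∑' n : ℤ, 16 * ((1 + (n : ℝ) ^ 2)⁻¹) ^ 2

theorem rollBound_nonneg : 0 ≤ rollBound := tsum_nonneg fun n => by positivity

/-- The solution operator of `((1 + κ ∂ₓ²)² - ε²) w = f` off the critical modes. -/
noncomputable def rollSolve (κ ε : ℝ) (f : C(Torus, ℝ)) : C(Torus, ℝ) :=
  cosSeries fun n => rollMultiplier κ ε n * cosCoeff n f

/-- A Lipschitz constant, per unit radius, of the nonlinearity on balls of radius at most one. -/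
def rollLipschitz (b s : ℝ) : ℝ := 2 * |b| + 3 * |s|

theorem rollLipschitz_nonneg (b s : ℝ) : 0 ≤ rollLipschitz b s := by
  unfold rollLipschitz; positivity

/-- The difference factors through `u - v` with a cofactor of order `R`; the assumption `R ≤ 1`
bounds the cubic part `R²` by `R`. The factor `R` is what makes the fixed point map a contraction on
small balls. -/
theorem norm_rollNonlinearity_sub_le (b s : ℝ) {R : ℝ} (hR : R ≤ 1) {u v : C(Torus, ℝ)}
    (hu : ‖u‖ ≤ R) (hv : ‖v‖ ≤ R) :
    ‖rollNonlinearity b s u - rollNonlinearity b s v‖ ≤ rollLipschitz b s * R * ‖u - v‖ := by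
  have hR0 : 0 ≤ R := (norm_nonneg _).trans hu
  have hB := rollLipschitz_nonneg b s
  have e : rollNonlinearity b s u - rollNonlinearity b s v
      = (b • (u + v) - s • (u ^ 2 + u * v + v ^ 2)) * (u - v) := by
    ext x
    simp only [rollNonlinearity_apply, ContinuousMap.sub_apply, ContinuousMap.mul_apply,
      ContinuousMap.smul_apply, ContinuousMap.add_apply, ContinuousMap.pow_apply, smul_eq_mul]
    ring
  rw [e]
  refine (norm_mul_le _ _).trans ?_
  gcongr
  calc ‖b • (u + v) - s • (u ^ 2 + u * v + v ^ 2)‖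
      ≤ |b| * (R + R) + |s| * (R ^ 2 + R * R + R ^ 2) := by
        refine (norm_sub_le _ _).trans ?_
        rw [norm_smul, norm_smul, Real.norm_eq_abs, Real.norm_eq_abs]
        gcongr
        · exact (norm_add_le _ _).trans (by gcongr)
        · refine (norm_add₃_le).trans ?_
          gcongr
          · exact (norm_pow_le u 2).trans (by gcongr)
          · exact (norm_mul_le _ _).trans (by gcongr)
          · exact (norm_pow_le v 2).trans (by gcongr)
    _ ≤ rollLipschitz b s * R := by
        unfold rollLipschitz
        nlinarith [mul_nonneg (abs_nonneg s) (mul_nonneg hR0 (sub_nonneg.mpr hR))]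

theorem norm_rollNonlinearity_le (b s : ℝ) {u : C(Torus, ℝ)} (hu : ‖u‖ ≤ 1) :
    ‖rollNonlinearity b s u‖ ≤ rollLipschitz b s * ‖u‖ ^ 2 := by
  have h := norm_rollNonlinearity_sub_le b s hu le_rfl (v := 0) (by simp)
  have h0 : rollNonlinearity b s 0 = 0 := by ext x; simp [rollNonlinearity_apply]
  rw [h0, sub_zero, sub_zero] at h
  linarith [h, sq ‖u‖, mul_assoc (rollLipschitz b s) ‖u‖ ‖u‖]

section Solve

variable {κ ε : ℝ}

theorem summable_rollSolve (hε : 0 ≤ ε) (hε' : ε ≤ 1 / 4) (hκ : |κ - 1| ≤ ε) (f : C(Torus, ℝ)) :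
    Summable fun n => rollMultiplier κ ε n * cosCoeff n f := by
  refine Summable.of_norm_bounded ((summable_inv_one_add_sq_sq.mul_left 16).mul_right ‖f‖)
    fun n => ?_
  rw [norm_mul]
  exact mul_le_mul (abs_rollMultiplier_le hε hε' hκ n) (abs_cosCoeff_le n f) (norm_nonneg _)
    (by positivity)

theorem norm_rollSolve_le (hε : 0 ≤ ε) (hε' : ε ≤ 1 / 4) (hκ : |κ - 1| ≤ ε) (f : C(Torus, ℝ)) :
    ‖rollSolve κ ε f‖ ≤ rollBound * ‖f‖ := by
  rw [rollBound, ← tsum_mul_right]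
  refine norm_cosSeries_le ((summable_inv_one_add_sq_sq.mul_left 16).mul_right ‖f‖) fun n => ?_
  rw [abs_mul]
  exact mul_le_mul (abs_rollMultiplier_le hε hε' hκ n) (abs_cosCoeff_le n f) (abs_nonneg _)
    (by positivity)

theorem rollSolve_sub (hε : 0 ≤ ε) (hε' : ε ≤ 1 / 4) (hκ : |κ - 1| ≤ ε) (f g : C(Torus, ℝ)) :
    rollSolve κ ε (f - g) = rollSolve κ ε f - rollSolve κ ε g := by
  have h1 := (hasSum_cosSeries (summable_rollSolve hε hε' hκ f)).sub
    (hasSum_cosSeries (summable_rollSolve hε hε' hκ g))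
  refine (hasSum_cosSeries (summable_rollSolve hε hε' hκ (f - g))).unique ?_
  refine h1.congr_fun fun n => ?_
  rw [map_sub, mul_sub, sub_smul]

theorem cosCoeff_rollSolve (hε : 0 ≤ ε) (hε' : ε ≤ 1 / 4) (hκ : |κ - 1| ≤ ε) (f : C(Torus, ℝ))
    (n : ℤ) : cosCoeff n (rollSolve κ ε f) = rollMultiplier κ ε n * cosCoeff n f :=
  cosCoeff_cosSeries (summable_rollSolve hε hε' hκ f)
    (fun n => by rw [rollMultiplier_neg, cosCoeff_neg]) n

theorem even_rollSolve (hε : 0 ≤ ε) (hε' : ε ≤ 1 / 4) (hκ : |κ - 1| ≤ ε) (f : C(Torus, ℝ))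
    (x : Torus) : rollSolve κ ε f (-x) = rollSolve κ ε f x :=
  cosSeries_apply_neg (summable_rollSolve hε hε' hκ f) x

variable {b s a R : ℝ} {u : C(Torus, ℝ)}

/-- A priori bounds for the noncritical part of the roll equation. -/
theorem rollSplit_bounds (hε : 0 ≤ ε) (hε' : ε ≤ 1 / 4) (hκ : |κ - 1| ≤ ε) (hR : R ≤ 1)
    (hRM : rollBound * rollLipschitz b s * R ≤ 1 / 2) (hu : ‖u‖ ≤ R)
    (h : u = (2 * a) • cosFun 1 + rollSolve κ ε (rollNonlinearity b s u)) :
    ‖u‖ ≤ 4 * |a| ∧ ‖u - (2 * a) • cosFun 1‖ ≤ 16 * (rollBound * rollLipschitz b s) * a ^ 2 := by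
  have hM := rollBound_nonneg
  have hB := rollLipschitz_nonneg b s
  have h1 : ‖u - (2 * a) • cosFun 1‖ ≤ rollBound * rollLipschitz b s * ‖u‖ ^ 2 := by
    have : u - (2 * a) • cosFun 1 = rollSolve κ ε (rollNonlinearity b s u) := by
      nth_rewrite 1 [h]; abel
    rw [this, mul_assoc]
    exact (norm_rollSolve_le hε hε' hκ _).trans
      (mul_le_mul_of_nonneg_left (norm_rollNonlinearity_le b s (hu.trans hR)) hM)
  have hp : ‖(2 * a) • cosFun 1‖ ≤ 2 * |a| := by
    refine (norm_smul_cosFun_le (c := fun _ => 2 * a) 1).trans (le_of_eq ?_)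
    rw [abs_mul, abs_two]
  have h2 : ‖u‖ ≤ 2 * |a| + ‖u - (2 * a) • cosFun 1‖ := by
    calc ‖u‖ = ‖(2 * a) • cosFun 1 + (u - (2 * a) • cosFun 1)‖ := by congr 1; abel
      _ ≤ _ := (norm_add_le _ _).trans (by gcongr)
  -- Smallness of `R` lets the quadratic term be absorbed: `‖u‖ ≤ 2|a| + ‖u‖ / 2`.
  have h3 : rollBound * rollLipschitz b s * ‖u‖ ^ 2 ≤ 1 / 2 * ‖u‖ := by
    have h4 : rollBound * rollLipschitz b s * ‖u‖ ≤ 1 / 2 :=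
      (mul_le_mul_of_nonneg_left hu (mul_nonneg hM hB)).trans hRM
    nlinarith [norm_nonneg u]
  have h5 : ‖u‖ ≤ 4 * |a| := by linarith
  refine ⟨h5, h1.trans ?_⟩
  have h6 : ‖u‖ ^ 2 ≤ 16 * a ^ 2 := by
    rw [← sq_abs a]
    nlinarith [norm_nonneg u, abs_nonneg a]
  nlinarith [mul_le_mul_of_nonneg_left h6 (mul_nonneg hM hB)]

theorem cosCoeff_cosFun_one (n : ℤ) :
    cosCoeff n (cosFun 1) = if n = 1 ∨ n = -1 then 1 / 2 else 0 := by
  rw [cosCoeff_cosFun]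
  by_cases h1 : n = 1
  · subst h1; norm_num
  by_cases h2 : n = -1
  · subst h2; norm_num
  · simp [h1, h2]

/-- Every roll solves the split equation. -/
theorem rollSplit_of_coeff (hε : 0 ≤ ε) (hε' : ε ≤ 1 / 4) (hκ : |κ - 1| ≤ ε)
    (heven : ∀ x, u (-x) = u x)
    (h : ∀ n : ℤ, ((1 - κ * (n : ℝ) ^ 2) ^ 2 - ε ^ 2) * cosCoeff n u
      = cosCoeff n (rollNonlinearity b s u)) :
    u = (2 * cosCoeff 1 u) • cosFun 1 + rollSolve κ ε (rollNonlinearity b s u) := by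
  refine eq_of_cosCoeff_eq heven (fun x => ?_) fun n => ?_
  · rw [ContinuousMap.add_apply, ContinuousMap.add_apply, ContinuousMap.smul_apply,
      ContinuousMap.smul_apply, cosFun_apply_neg, even_rollSolve hε hε' hκ]
  · rw [map_add, map_smul, cosCoeff_rollSolve hε hε' hκ, cosCoeff_cosFun_one, rollMultiplier,
      smul_eq_mul]
    split_ifs with hn
    · have : cosCoeff n u = cosCoeff 1 u := by
        rcases hn with rfl | rfl
        · rfl
        · exact cosCoeff_neg 1 u
      rw [this]
      ring
    · have h0 : (1 - κ * (n : ℝ) ^ 2) ^ 2 - ε ^ 2 ≠ 0 := by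
        have h1 := rollSymbol_ge hε hε' hκ hn
        have := one_add_sq_pos n
        have h2 : 0 < (1 + (n : ℝ) ^ 2) ^ 2 / 16 := by positivity
        exact (h2.trans_le h1).ne'
      rw [← h n, inv_mul_cancel_left₀ h0]
      ring

/-- A solution of the split equation which also solves the critical mode is a smooth solution. -/
theorem contDiff_and_coeff_of_rollSplit (hε : 0 ≤ ε) (hε' : ε ≤ 1 / 4) (hκ : |κ - 1| ≤ ε)
    (heven : ∀ x, u (-x) = u x)
    (h : u = (2 * a) • cosFun 1 + rollSolve κ ε (rollNonlinearity b s u))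
    (hcrit : (ε ^ 2 - (1 - κ) ^ 2) * a + cosCoeff 1 (rollNonlinearity b s u) = 0) :
    ContDiff ℝ 4 (fun x : ℝ => u (x : Torus)) ∧ cosCoeff 1 u = a ∧
      ∀ n : ℤ, ((1 - κ * (n : ℝ) ^ 2) ^ 2 - ε ^ 2) * cosCoeff n u
        = cosCoeff n (rollNonlinearity b s u) := by
  have hc : ∀ n, cosCoeff n u = (2 * a) * (if n = 1 ∨ n = -1 then 1 / 2 else 0)
      + rollMultiplier κ ε n * cosCoeff n (rollNonlinearity b s u) := by
    intro n
    conv_lhs => rw [h]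
    rw [map_add, map_smul, cosCoeff_rollSolve hε hε' hκ, cosCoeff_cosFun_one, smul_eq_mul]
  -- This bound is used twice to bootstrap: two inverse weights give `C²`, and then the nonlinearity
  -- is `C²` and supplies a third, giving `C⁴`. The factor `8` makes the first term equal to `|a|`
  -- at `n = ±1`.
  have hbound : ∀ n : ℤ, |cosCoeff n u| ≤ 8 * |a| * ((1 + (n : ℝ) ^ 2)⁻¹) ^ 3
      + 16 * ((1 + (n : ℝ) ^ 2)⁻¹) ^ 2 * |cosCoeff n (rollNonlinearity b s u)| := by
    intro n
    have hw := inv_pos.mpr (one_add_sq_pos n)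
    rw [hc]
    refine (abs_add_le _ _).trans ?_
    rw [abs_mul, abs_mul, abs_mul, abs_two]
    refine add_le_add ?_
      (mul_le_mul_of_nonneg_right (abs_rollMultiplier_le hε hε' hκ n) (abs_nonneg _))
    split_ifs with hn
    · have : ((n : ℝ)) ^ 2 = 1 := by rcases hn with rfl | rfl <;> norm_num
      rw [this]
      norm_num
      linarith [abs_nonneg a]
    · rw [abs_zero, mul_zero]; positivity
  have hC2 : ContDiff ℝ 2 (fun x : ℝ => u (x : Torus)) := by
    have := contDiff_of_abs_cosCoeff_le heven (k := 1)
      (C := 8 * |a| + 16 * ‖rollNonlinearity b s u‖) fun n => ?_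
    · simpa using this
    · refine (hbound n).trans ?_
      have hw := inv_pos.mpr (one_add_sq_pos n)
      have hw1 := inv_one_add_sq_le_one n
      rw [add_mul]
      refine add_le_add ?_ ?_
      · exact mul_le_mul_of_nonneg_left (pow_le_pow_of_le_one hw.le hw1 (by norm_num))
          (by positivity)
      · have := mul_le_mul_of_nonneg_left (abs_cosCoeff_le n (rollNonlinearity b s u))
          (by positivity : (0 : ℝ) ≤ 16 * ((1 + (n : ℝ) ^ 2)⁻¹) ^ 2)
        rw [show 1 + 1 = 2 from rfl]
        linarith
  have hN2 : ContDiff ℝ 2 (fun x : ℝ => rollNonlinearity b s u (x : Torus)) := by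
    simp only [rollNonlinearity_apply]
    exact (contDiff_const.mul (hC2.pow 2)).sub (contDiff_const.mul (hC2.pow 3))
  obtain ⟨C, hC0, hC⟩ := abs_cosCoeff_le_of_contDiff hN2
  have hC4 : ContDiff ℝ 4 (fun x : ℝ => u (x : Torus)) := by
    have := contDiff_of_abs_cosCoeff_le heven (k := 2) (C := 8 * |a| + 16 * C) fun n => ?_
    · simpa using this
    · refine (hbound n).trans ?_
      have hw := inv_pos.mpr (one_add_sq_pos n)
      have := mul_le_mul_of_nonneg_left (hC n)
        (by positivity : (0 : ℝ) ≤ 16 * ((1 + (n : ℝ) ^ 2)⁻¹) ^ 2)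
      nlinarith
  have h1 : cosCoeff 1 u = a := by
    rw [hc 1]
    simp [rollMultiplier]
    ring
  refine ⟨hC4, h1, fun n => ?_⟩
  by_cases hn : n = 1 ∨ n = -1
  · have hsq : (n : ℝ) ^ 2 = 1 := by rcases hn with rfl | rfl <;> norm_num
    have hcn : ∀ f, cosCoeff n f = cosCoeff 1 f := by
      intro f
      rcases hn with rfl | rfl
      · rfl
      · exact cosCoeff_neg 1 f
    rw [hcn, hcn, h1, hsq, mul_one]
    linarith
  · have h0 : (1 - κ * (n : ℝ) ^ 2) ^ 2 - ε ^ 2 ≠ 0 := by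
      have h1 := rollSymbol_ge hε hε' hκ hn
      have := one_add_sq_pos n
      have h2 : 0 < (1 + (n : ℝ) ^ 2) ^ 2 / 16 := by positivity
      exact (h2.trans_le h1).ne'
    rw [hc n, rollMultiplier, if_neg hn, if_neg hn, mul_zero, zero_add, mul_inv_cancel_left₀ h0]

/-- The noncritical part of the roll equation is solvable for small amplitude. -/
theorem exists_rollSplit (hε : 0 ≤ ε) (hε' : ε ≤ 1 / 4) (hκ : |κ - 1| ≤ ε) (hR : R ≤ 1)
    (hRM : rollBound * rollLipschitz b s * R ≤ 1 / 2) (ha : |a| ≤ R / 4) :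
    ∃ u : C(Torus, ℝ), (∀ x, u (-x) = u x) ∧ ‖u‖ ≤ R ∧
      u = (2 * a) • cosFun 1 + rollSolve κ ε (rollNonlinearity b s u) := by
  have hM := rollBound_nonneg
  have hB := rollLipschitz_nonneg b s
  have hR0 : 0 ≤ R := by linarith [abs_nonneg a]
  set S : Set C(Torus, ℝ) := {u | (∀ x, u (-x) = u x) ∧ ‖u‖ ≤ R} with hS
  set T : C(Torus, ℝ) → C(Torus, ℝ) := fun u =>
    (2 * a) • cosFun 1 + rollSolve κ ε (rollNonlinearity b s u) with hT
  have hlip : ∀ u ∈ S, ∀ v ∈ S, ‖T u - T v‖ ≤ 1 / 2 * ‖u - v‖ := by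
    intro u hu v hv
    have e : T u - T v = rollSolve κ ε (rollNonlinearity b s u - rollNonlinearity b s v) := by
      rw [rollSolve_sub hε hε' hκ]; simp only [hT]; abel
    rw [e]
    calc _ ≤ rollBound * (rollLipschitz b s * R * ‖u - v‖) :=
          (norm_rollSolve_le hε hε' hκ _).trans
            (mul_le_mul_of_nonneg_left (norm_rollNonlinearity_sub_le b s hR hu.2 hv.2) hM)
      _ = rollBound * rollLipschitz b s * R * ‖u - v‖ := by ring
      _ ≤ _ := by gcongr
  have h0 : (0 : C(Torus, ℝ)) ∈ S := ⟨fun x => rfl, by simpa using hR0⟩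
  have hp : ‖T 0‖ ≤ R / 2 := by
    have e : T 0 = (2 * a) • cosFun 1 := by
      have e1 : rollNonlinearity b s 0 = 0 := by ext x; simp [rollNonlinearity_apply]
      have e2 : rollSolve κ ε 0 = 0 := by
        have := rollSolve_sub hε hε' hκ 0 0
        simpa using this
      simp only [hT, e1, e2, add_zero]
    rw [e]
    refine (norm_smul_cosFun_le (c := fun _ => 2 * a) 1).trans ?_
    rw [abs_mul, abs_two]
    linarith
  have hmaps : MapsTo T S S := by
    intro u hu
    refine ⟨fun x => ?_, ?_⟩
    · simp only [hT, ContinuousMap.add_apply, ContinuousMap.smul_apply, cosFun_apply_neg,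
        even_rollSolve hε hε' hκ]
    · have h1 := hlip u hu 0 h0
      rw [sub_zero] at h1
      have h2 := norm_add_le (T u - T 0) (T 0)
      rw [sub_add_cancel] at h2
      linarith [hu.2]
  have hclosed : IsClosed S := by
    have e : S = (⋂ x, {u | u (-x) = u x}) ∩ {u | ‖u‖ ≤ R} := by
      ext u
      simp [hS]
    rw [e]
    exact (isClosed_iInter fun x => isClosed_eq (ContinuousMap.evalCLM ℝ _).continuous
      (ContinuousMap.evalCLM ℝ _).continuous).inter (isClosed_le continuous_norm continuous_const)
  have hcontr : ContractingWith (1 / 2) (hmaps.restrict T S S) := by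
    refine ⟨by norm_num, LipschitzWith.of_dist_le_mul fun u v => ?_⟩
    rw [Subtype.dist_eq, Subtype.dist_eq, dist_eq_norm, dist_eq_norm]
    simpa using hlip u u.2 v v.2
  obtain ⟨u, huS, hfix, -⟩ := hcontr.exists_fixedPoint' hclosed.isComplete hmaps h0
    (edist_ne_top _ _)
  exact ⟨u, huS.1, huS.2, hfix.symm⟩

/-- Lipschitz dependence of the solution of the split equation on the amplitude. -/
theorem rollSplit_lipschitz (hε : 0 ≤ ε) (hε' : ε ≤ 1 / 4) (hκ : |κ - 1| ≤ ε) (hR : R ≤ 1)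
    (hRM : rollBound * rollLipschitz b s * R ≤ 1 / 2) {a' : ℝ} {v : C(Torus, ℝ)} (hu : ‖u‖ ≤ R)
    (hv : ‖v‖ ≤ R) (h : u = (2 * a) • cosFun 1 + rollSolve κ ε (rollNonlinearity b s u))
    (h' : v = (2 * a') • cosFun 1 + rollSolve κ ε (rollNonlinearity b s v)) :
    ‖u - v‖ ≤ 4 * |a - a'| := by
  have e : u - v = (2 * (a - a')) • cosFun 1
      + rollSolve κ ε (rollNonlinearity b s u - rollNonlinearity b s v) := by
    rw [rollSolve_sub hε hε' hκ]
    nth_rewrite 1 [h, h']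
    module
  have h1 : ‖rollSolve κ ε (rollNonlinearity b s u - rollNonlinearity b s v)‖
      ≤ 1 / 2 * ‖u - v‖ := by
    calc _ ≤ rollBound * (rollLipschitz b s * R * ‖u - v‖) :=
          (norm_rollSolve_le hε hε' hκ _).trans
            (mul_le_mul_of_nonneg_left (norm_rollNonlinearity_sub_le b s hR hu hv)
              rollBound_nonneg)
      _ = rollBound * rollLipschitz b s * R * ‖u - v‖ := by ring
      _ ≤ _ := by gcongr
  have h2 : ‖(2 * (a - a')) • cosFun 1‖ ≤ 2 * |a - a'| := by
    refine (norm_smul_cosFun_le (c := fun _ => 2 * (a - a')) 1).trans (le_of_eq ?_)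
    rw [abs_mul, abs_two]
  have h3 := norm_add_le ((2 * (a - a')) • cosFun 1)
    (rollSolve κ ε (rollNonlinearity b s u - rollNonlinearity b s v))
  rw [← e] at h3
  linarith

end Solve

/-! ### The amplitude equation and existence of rolls. -/

theorem abs_rollMultiplier_zero_sub_one_le {ε κ : ℝ} (hε : 0 ≤ ε) (hε' : ε ≤ 1 / 4) :
    |rollMultiplier κ ε 0 - 1| ≤ ε ∧ |rollMultiplier κ ε 0| ≤ 2 := by
  have e : rollMultiplier κ ε 0 = (1 - ε ^ 2)⁻¹ := by simp [rollMultiplier]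
  have h1 : 15 / 16 ≤ 1 - ε ^ 2 := by nlinarith
  have h2 : 0 < 1 - ε ^ 2 := by linarith
  rw [e]
  constructor
  · have : (1 - ε ^ 2)⁻¹ - 1 = ε ^ 2 / (1 - ε ^ 2) := by field_simp; ring
    rw [this, abs_of_nonneg (by positivity), div_le_iff₀ h2]
    nlinarith
  · rw [abs_of_pos (inv_pos.mpr h2)]
    exact inv_le_of_inv_le₀ (by norm_num) (by linarith)

/-- The limit `1/9` is `(1 - n²)⁻²` at `n = 2`. Together with the limit `1` at `n = 0` it is the
response of the mean and second harmonic to `b p²`, hence the source of `38/9 = 2 (2 + 1/9)`. -/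
theorem abs_rollMultiplier_two_sub_le {ε κ : ℝ} (hε : 0 ≤ ε) (hε' : ε ≤ 1 / 4)
    (hκ : |κ - 1| ≤ ε) :
    |rollMultiplier κ ε 2 - 1 / 9| ≤ 2 * ε ∧ |rollMultiplier κ ε 2| ≤ 2 := by
  obtain ⟨hκ1, hκ2⟩ := abs_le.mp hκ
  have e : rollMultiplier κ ε 2 = ((1 - κ * 4) ^ 2 - ε ^ 2)⁻¹ := by
    rw [rollMultiplier, if_neg (by norm_num)]
    norm_num
  set X := (1 - κ * 4) ^ 2 - ε ^ 2 with hX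
  have hX3 : 3 ≤ X := by rw [hX]; nlinarith
  have hX0 : 0 < X := by linarith
  have hX9 : |9 - X| ≤ 28 * ε := by
    rw [hX, abs_le]
    constructor <;> nlinarith
  rw [e]
  constructor
  · have : X⁻¹ - 1 / 9 = (9 - X) / (9 * X) := by field_simp
    rw [this, abs_div, abs_of_pos (by positivity : 0 < 9 * X), div_le_iff₀ (by positivity)]
    nlinarith
  · rw [abs_of_pos (inv_pos.mpr hX0)]
    exact inv_le_of_inv_le₀ (by norm_num) (by linarith)

set_option maxHeartbeats 1000000 in
/-- The resonant coefficient of the nonlinearity on the branch of amplitude `a` is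
`-(27 s - 38 b²) / 9 * a³` to leading order. -/
theorem exists_amplitude_expansion {b s R : ℝ} (hR : R ≤ 1)
    (hRM : rollBound * rollLipschitz b s * R ≤ 1 / 2) :
    ∃ K : ℝ, 0 ≤ K ∧ ∀ (ε κ a : ℝ) (u : C(Torus, ℝ)), 0 ≤ ε → ε ≤ 1 / 4 → |κ - 1| ≤ ε → 0 ≤ a →
      ‖u‖ ≤ R → u = (2 * a) • cosFun 1 + rollSolve κ ε (rollNonlinearity b s u) →
      cosCoeff 1 (rollNonlinearity b s u)
        ≤ -((27 * s - 38 * b ^ 2) / 9) * a ^ 3 + K * (a + ε) * a ^ 3 := by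
  set C₁ := 16 * (rollBound * rollLipschitz b s) with hC₁
  have hC₁0 : 0 ≤ C₁ := by
    have := rollBound_nonneg
    have := rollLipschitz_nonneg b s
    positivity
  set C₂ := 6 * |b| * C₁ + 64 * |s| with hC₂
  have hC₂0 : 0 ≤ C₂ := by positivity
  refine ⟨8 * |b| * C₂ + |b| * C₁ ^ 2 + 28 * |s| * C₁ + 8 * b ^ 2, by positivity, ?_⟩
  intro ε κ a u hε hε' hκ ha hu h
  obtain ⟨hu4, hw⟩ := rollSplit_bounds hε hε' hκ hR hRM hu h
  rw [abs_of_nonneg ha] at hu4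
  rw [← hC₁] at hw
  set p : C(Torus, ℝ) := (2 * a) • cosFun 1 with hp
  set w := u - p with hwdef
  have hup : u = p + w := by rw [hwdef]; abel
  have hwsol : w = rollSolve κ ε (rollNonlinearity b s u) := by
    rw [hwdef]; nth_rewrite 1 [h]; abel
  have hpn : ‖p‖ ≤ 2 * a := by
    refine (norm_smul_cosFun_le (c := fun _ => 2 * a) 1).trans (le_of_eq ?_)
    rw [abs_of_nonneg (by positivity)]
  have hmul : ∀ n f, cosCoeff n (p * f) = a * (cosCoeff (n - 1) f + cosCoeff (n + 1) f) := by
    intro n f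
    rw [hp, smul_mul_assoc, map_smul, cosCoeff_cosFun_one_mul, smul_eq_mul]
    ring
  have hpc : ∀ n, cosCoeff n p = if n = 1 ∨ n = -1 then a else 0 := by
    intro n
    rw [hp, map_smul, cosCoeff_cosFun_one, smul_eq_mul]
    split_ifs <;> ring
  have hp2 : ∀ n, cosCoeff n (p * p)
      = a * ((if n - 1 = 1 ∨ n - 1 = -1 then a else 0)
        + (if n + 1 = 1 ∨ n + 1 = -1 then a else 0)) := by
    intro n
    rw [hmul, hpc, hpc]
  have hp20 : cosCoeff 0 (p * p) = 2 * a ^ 2 := by rw [hp2]; norm_num; ring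
  have hp21 : cosCoeff 1 (p * p) = 0 := by rw [hp2]; norm_num
  have hp22 : cosCoeff 2 (p * p) = a ^ 2 := by rw [hp2]; norm_num; ring
  have hp31 : cosCoeff 1 (p * (p * p)) = 3 * a ^ 3 := by
    rw [hmul, show (1 : ℤ) - 1 = 0 by norm_num, show (1 : ℤ) + 1 = 2 by norm_num, hp20, hp22]
    ring
  have hquad : ‖rollNonlinearity b s u - b • (p * p)‖ ≤ C₂ * a ^ 3 := by
    have e : rollNonlinearity b s u - b • (p * p) = b • (w * (u + p)) - s • (u * (u * u)) := by
      rw [hwdef]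
      ext x
      simp only [rollNonlinearity_apply, ContinuousMap.sub_apply, ContinuousMap.mul_apply,
        ContinuousMap.smul_apply, ContinuousMap.add_apply, smul_eq_mul]
      ring
    rw [e]
    calc _ ≤ |b| * (C₁ * a ^ 2 * (4 * a + 2 * a)) + |s| * (4 * a * (4 * a * (4 * a))) := by
          refine (norm_sub_le _ _).trans ?_
          rw [norm_smul, norm_smul, Real.norm_eq_abs, Real.norm_eq_abs]
          gcongr
          · exact (norm_mul_le _ _).trans
              (mul_le_mul hw ((norm_add_le _ _).trans (add_le_add hu4 hpn)) (norm_nonneg _)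
                (by positivity))
          · refine (norm_mul_le _ _).trans (mul_le_mul hu4 ?_ (norm_nonneg _) (by positivity))
            exact (norm_mul_le _ _).trans (mul_le_mul hu4 hu4 (norm_nonneg _) (by positivity))
      _ = C₂ * a ^ 3 := by rw [hC₂]; ring
  have hqc : ∀ n, |cosCoeff n (rollNonlinearity b s u) - b * cosCoeff n (p * p)| ≤ C₂ * a ^ 3 := by
    intro n
    have := (abs_cosCoeff_le n (rollNonlinearity b s u - b • (p * p))).trans hquad
    rwa [map_sub, map_smul, smul_eq_mul] at this
  have hwc : ∀ n, cosCoeff n w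
      = rollMultiplier κ ε n * cosCoeff n (rollNonlinearity b s u) := by
    intro n
    rw [hwsol, cosCoeff_rollSolve hε hε' hκ]
  have hm0 := abs_rollMultiplier_zero_sub_one_le (κ := κ) hε hε'
  have hm2 := abs_rollMultiplier_two_sub_le hε hε' hκ
  -- Here `m` is the limiting multiplier at mode `n` and `c a²` the coefficient of `p²`. To leading
  -- order `w` is the linear response to `b p²`.
  have hwn : ∀ (n : ℤ) (m c : ℝ), |rollMultiplier κ ε n - m| * |c| ≤ 2 * ε →
      |rollMultiplier κ ε n| ≤ 2 → cosCoeff n (p * p) = c * a ^ 2 →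
      |cosCoeff n w - m * (b * (c * a ^ 2))| ≤ 2 * C₂ * a ^ 3 + 2 * ε * |b| * a ^ 2 := by
    intro n m c h1 h2 h3
    have h4 := hqc n
    rw [h3] at h4
    have e : cosCoeff n w - m * (b * (c * a ^ 2))
        = rollMultiplier κ ε n * (cosCoeff n (rollNonlinearity b s u) - b * (c * a ^ 2))
          + (rollMultiplier κ ε n - m) * c * (b * a ^ 2) := by rw [hwc]; ring
    rw [e]
    refine (abs_add_le _ _).trans (add_le_add ?_ ?_)
    · rw [abs_mul, mul_assoc]
      exact mul_le_mul h2 h4 (abs_nonneg _) (by norm_num)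
    · rw [abs_mul, abs_mul, abs_mul b, abs_of_nonneg (sq_nonneg a), mul_assoc (2 * ε)]
      exact mul_le_mul_of_nonneg_right h1 (by positivity)
  have hw0 := hwn 0 1 2 (by rw [abs_two]; linarith [hm0.1]) hm0.2 hp20
  have hw2 := hwn 2 (1 / 9) 1 (by rw [abs_one]; linarith [hm2.1]) hm2.2 (by rw [hp22]; ring)
  have hrem : ‖b • (w * w) - s • (w * (u * u + u * p + p * p))‖
      ≤ |b| * (C₁ * a ^ 2 * (C₁ * a ^ 2)) + |s| * (C₁ * a ^ 2 * (28 * a ^ 2)) := by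
    refine (norm_sub_le _ _).trans ?_
    rw [norm_smul, norm_smul, Real.norm_eq_abs, Real.norm_eq_abs]
    gcongr
    · exact (norm_mul_le _ _).trans (mul_le_mul hw hw (norm_nonneg _) (by positivity))
    · refine (norm_mul_le _ _).trans (mul_le_mul hw ?_ (norm_nonneg _) (by positivity))
      calc ‖u * u + u * p + p * p‖ ≤ 4 * a * (4 * a) + 4 * a * (2 * a) + 2 * a * (2 * a) := by
            refine norm_add₃_le.trans ?_
            gcongr
            · exact (norm_mul_le _ _).trans (mul_le_mul hu4 hu4 (norm_nonneg _) (by positivity))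
            · exact (norm_mul_le _ _).trans (mul_le_mul hu4 hpn (norm_nonneg _) (by positivity))
            · exact (norm_mul_le _ _).trans (mul_le_mul hpn hpn (norm_nonneg _) (by positivity))
        _ = 28 * a ^ 2 := by ring
  -- Expand about `p`: the term `b p²` has no first mode, `2b p w` sees only modes `0` and `2` of
  -- `w`, `-s p³` gives `-3s a³`, and the rest is `O(a⁴)` because `w = O(a²)`.
  have hsplit : cosCoeff 1 (rollNonlinearity b s u)
      = 2 * b * (a * (cosCoeff 0 w + cosCoeff 2 w)) - s * (3 * a ^ 3)
        + cosCoeff 1 (b • (w * w) - s • (w * (u * u + u * p + p * p))) := by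
    have e : rollNonlinearity b s u = b • (p * p) + (2 * b) • (p * w) - s • (p * (p * p))
        + (b • (w * w) - s • (w * (u * u + u * p + p * p))) := by
      rw [hwdef]
      ext x
      simp only [rollNonlinearity_apply, ContinuousMap.sub_apply, ContinuousMap.mul_apply,
        ContinuousMap.smul_apply, ContinuousMap.add_apply, smul_eq_mul]
      ring
    conv_lhs => rw [e]
    rw [map_add, map_sub, map_add, map_smul, map_smul, map_smul, hp21, hp31, hmul,
      show (1 : ℤ) - 1 = 0 by norm_num, show (1 : ℤ) + 1 = 2 by norm_num]
    simp only [smul_eq_mul]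
    ring
  have hr := (le_abs_self _).trans ((abs_cosCoeff_le 1 _).trans hrem)
  have hmain : 2 * b * (a * (cosCoeff 0 w + cosCoeff 2 w))
      ≤ 38 / 9 * b ^ 2 * a ^ 3 + 2 * |b| * a * (2 * (2 * C₂ * a ^ 3 + 2 * ε * |b| * a ^ 2)) := by
    have e : 2 * b * (a * (cosCoeff 0 w + cosCoeff 2 w)) = 38 / 9 * b ^ 2 * a ^ 3
        + 2 * b * a * ((cosCoeff 0 w - 1 * (b * (2 * a ^ 2)))
          + (cosCoeff 2 w - 1 / 9 * (b * (1 * a ^ 2)))) := by ring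
    rw [e]
    refine add_le_add le_rfl ((le_abs_self _).trans ?_)
    rw [abs_mul, abs_mul, abs_mul, abs_two, abs_of_nonneg ha]
    gcongr
    refine (abs_add_le _ _).trans ?_
    linarith
  rw [hsplit]
  have e1 : 2 * |b| * a * (2 * (2 * C₂ * a ^ 3 + 2 * ε * |b| * a ^ 2))
      = 8 * |b| * C₂ * a ^ 4 + 8 * b ^ 2 * ε * a ^ 3 := by
    rw [← sq_abs b]; ring
  have h8 : 0 ≤ (8 * |b| * C₂ + |b| * C₁ ^ 2 + 28 * |s| * C₁) * ε * a ^ 3 := by positivity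
  have h9 : 0 ≤ 8 * b ^ 2 * a * a ^ 3 := by positivity
  rw [e1] at hmain
  linarith

/-- Existence of small rolls, uniformly in the frequency parameter. -/
theorem exists_roll {b s ρ : ℝ} (hbs : 0 < 27 * s - 38 * b ^ 2) (hρ : 0 < ρ) (hρ1 : ρ ≤ 1)
    (hρM : rollBound * rollLipschitz b s * ρ ≤ 1 / 2) :
    ∃ ε₁ > 0, ε₁ ≤ 1 / 4 ∧ ∀ ε ∈ Ioc 0 ε₁, ∀ ω ∈ Ioo (-(1 / 2) : ℝ) (1 / 2),
      ∃ u : C(Torus, ℝ), IsRoll b s ε ω u ∧ ∀ x, |u x| ≤ ρ := by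
  obtain ⟨K, hK, hexp⟩ := exists_amplitude_expansion hρ1 hρM
  set q := (27 * s - 38 * b ^ 2) / 9 with hq
  have hq0 : 0 < q := by positivity
  -- The upper amplitude `a₀` is chosen independently of `ε` and `ω`, so that the remainder is
  -- dominated by the cubic term; afterwards `ε₁` makes the linear term negligible at `a₀`.
  set a₀ := min (ρ / 4) (q / (4 * (K + 1))) with ha₀
  have ha₀0 : 0 < a₀ := lt_min (by positivity) (by positivity)
  have ha₀K : K * a₀ ≤ q / 4 := by
    have h1 : a₀ ≤ q / (4 * (K + 1)) := min_le_right _ _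
    rw [le_div_iff₀ (by positivity)] at h1
    nlinarith
  set ε₁ := min (1 / 4) (min (q / (4 * (K + 1))) (q * a₀ ^ 2 / 4)) with hε₁
  have hε₁0 : 0 < ε₁ := lt_min (by norm_num) (lt_min (by positivity) (by positivity))
  refine ⟨ε₁, hε₁0, min_le_left _ _, ?_⟩
  rintro ε ⟨hε, hεε⟩ ω ⟨hω1, hω2⟩
  have hε4 : ε ≤ 1 / 4 := hεε.trans (min_le_left _ _)
  have hεK : K * ε ≤ q / 4 := by
    have h1 : ε ≤ q / (4 * (K + 1)) := hεε.trans ((min_le_right _ _).trans (min_le_left _ _))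
    rw [le_div_iff₀ (by positivity)] at h1
    nlinarith
  have hεq : ε ^ 2 ≤ q * a₀ ^ 2 / 4 := by
    have h1 : ε ≤ q * a₀ ^ 2 / 4 := hεε.trans ((min_le_right _ _).trans (min_le_right _ _))
    nlinarith
  set κ := 1 + 2 * ε * ω with hκdef
  have hω : |ω| < 1 / 2 := abs_lt.mpr ⟨by linarith, hω2⟩
  have hκ : |κ - 1| ≤ ε := by
    rw [hκdef, add_sub_cancel_left, abs_mul, abs_of_pos (by positivity : 0 < 2 * ε)]
    nlinarith
  -- `η = ε² (1 - 4ω²)`, so `|ω| < 1/2` is exactly the condition that the linear coefficient be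
  -- positive.
  set η := ε ^ 2 - (1 - κ) ^ 2 with hη
  have hη0 : 0 < η := by
    have h1 : η = ε ^ 2 * (1 - 4 * ω ^ 2) := by rw [hη, hκdef]; ring
    have h2 : ω ^ 2 < 1 / 4 := by rw [← sq_abs]; nlinarith [abs_nonneg ω]
    rw [h1]
    have : 0 < 1 - 4 * ω ^ 2 := by linarith
    positivity
  have hηε : η ≤ ε ^ 2 := by rw [hη]; nlinarith [sq_nonneg (1 - κ)]
  have hex : ∀ a ∈ Icc 0 a₀, ∃ u : C(Torus, ℝ), (∀ x, u (-x) = u x) ∧ ‖u‖ ≤ ρ ∧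
      u = (2 * a) • cosFun 1 + rollSolve κ ε (rollNonlinearity b s u) := fun a ha =>
    exists_rollSplit hε.le hε4 hκ hρ1 hρM
      (by rw [abs_of_nonneg ha.1]; exact ha.2.trans (min_le_left _ _))
  choose! U hUe hUn hU using hex
  set Ψ : ℝ → ℝ := fun a => η * a + cosCoeff 1 (rollNonlinearity b s (U a)) with hΨ
  -- The profiles come from an arbitrary choice, but the Lipschitz estimate applies to any solutions
  -- in the ball, so the choice is forced and continuous.
  have hUc : ContinuousOn U (Icc 0 a₀) := by
    have : LipschitzOnWith 4 U (Icc 0 a₀) := LipschitzOnWith.of_dist_le_mul fun a ha a' ha' => by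
      rw [dist_eq_norm, Real.dist_eq]
      exact rollSplit_lipschitz hε.le hε4 hκ hρ1 hρM (hUn a ha) (hUn a' ha') (hU a ha) (hU a' ha')
    exact this.continuousOn
  have hNc : Continuous (rollNonlinearity b s) := by
    unfold rollNonlinearity
    fun_prop
  have hΨc : ContinuousOn Ψ (Icc 0 a₀) :=
    (continuousOn_const.mul continuousOn_id).add
      ((cosCoeff 1).continuous.comp_continuousOn (hNc.comp_continuousOn hUc))
  have hB := rollLipschitz_nonneg b s
  -- At this amplitude the crude quadratic bound `16 L a²` on the resonant coefficient, with `L =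
  -- rollLipschitz b s`, is at most `η a`. Unlike `a₀`, it may depend on `ε` and `ω`; it only has to
  -- be positive, to exclude the trivial root.
  set a₁ := min a₀ (η / (16 * rollLipschitz b s + 1)) with ha₁
  have ha₁0 : 0 < a₁ := lt_min ha₀0 (by positivity)
  have ha₁₀ : a₁ ≤ a₀ := min_le_left _ _
  have hΨ1 : 0 ≤ Ψ a₁ := by
    have hmem : a₁ ∈ Icc 0 a₀ := ⟨ha₁0.le, ha₁₀⟩
    have h1 := (rollSplit_bounds hε.le hε4 hκ hρ1 hρM (hUn _ hmem) (hU _ hmem)).1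
    rw [abs_of_pos ha₁0] at h1
    have h2 := (abs_cosCoeff_le 1 _).trans
      (norm_rollNonlinearity_le b s ((hUn _ hmem).trans hρ1))
    have h3 : ‖U a₁‖ ^ 2 ≤ (4 * a₁) ^ 2 := by gcongr
    have h4 := (abs_le.mp (h2.trans (mul_le_mul_of_nonneg_left h3 hB))).1
    have h5 : a₁ ≤ η / (16 * rollLipschitz b s + 1) := min_le_right _ _
    rw [le_div_iff₀ (by positivity)] at h5
    simp only [hΨ]
    nlinarith
  have hΨ0 : Ψ a₀ ≤ 0 := by
    have hmem : a₀ ∈ Icc 0 a₀ := ⟨ha₀0.le, le_rfl⟩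
    have h1 := hexp ε κ a₀ (U a₀) hε.le hε4 hκ ha₀0.le (hUn _ hmem) (hU _ hmem)
    have h2 : 0 < a₀ ^ 3 := by positivity
    have h3 : K * (a₀ + ε) * a₀ ^ 3 ≤ q / 2 * a₀ ^ 3 := by
      gcongr
      linarith
    have h4 : η * a₀ ≤ q / 4 * a₀ ^ 3 := by
      calc η * a₀ ≤ q * a₀ ^ 2 / 4 * a₀ := by gcongr; exact hηε.trans hεq
        _ = _ := by ring
    simp only [hΨ]
    nlinarith [mul_pos hq0 h2]
  obtain ⟨a, ha, haΨ⟩ := intermediate_value_Icc' ha₁₀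
    (hΨc.mono (Icc_subset_Icc_left ha₁0.le)) ⟨hΨ0, hΨ1⟩
  have ha0 : 0 < a := ha₁0.trans_le ha.1
  have hmem : a ∈ Icc 0 a₀ := ⟨ha0.le, ha.2⟩
  obtain ⟨hC4, h1, hcoef⟩ := contDiff_and_coeff_of_rollSplit hε.le hε4 hκ (hUe a hmem) (hU a hmem)
    haΨ
  refine ⟨U a, ⟨hC4, fun x => ?_, fun h0 => ?_, ?_⟩, fun x => ?_⟩
  · rw [AddCircle.coe_neg, hUe a hmem]
  · rw [h0, map_zero] at h1
    exact ha0.ne h1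
  · exact (stationary_iff_cosCoeff hC4 (hUe a hmem)).mpr hcoef
  · exact ((U a).norm_coe_le_norm x).trans (hUn a hmem)

/-- Every small roll has the form `2a cos x + O(a²)` with `a ≠ 0`. -/
theorem IsRoll.bounds {b s ε ω ρ : ℝ} {u : C(Torus, ℝ)} (hu : IsRoll b s ε ω u) (hε : 0 < ε)
    (hε' : ε ≤ 1 / 4) (hω : |ω| ≤ 1 / 2) (hρ1 : ρ ≤ 1)
    (hρM : rollBound * rollLipschitz b s * ρ ≤ 1 / 2) (huρ : ‖u‖ ≤ ρ) :
    ∃ a : ℝ, a ≠ 0 ∧ |a| ≤ ρ ∧ ‖u‖ ≤ 4 * |a| ∧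
      ‖u - (2 * a) • cosFun 1‖ ≤ 16 * (rollBound * rollLipschitz b s) * a ^ 2 := by
  have heven : ∀ x, u (-x) = u x := fun x => by
    induction x using QuotientAddGroup.induction_on with
    | H x => rw [← AddCircle.coe_neg]; exact hu.even x
  have hκ : |(1 + 2 * ε * ω) - 1| ≤ ε := by
    rw [add_sub_cancel_left, abs_mul, abs_of_pos (by positivity : 0 < 2 * ε)]
    nlinarith
  have hsplit := rollSplit_of_coeff hε.le hε' hκ heven
    ((stationary_iff_cosCoeff hu.contDiff heven).mp hu.stationary)
  obtain ⟨h1, h2⟩ := rollSplit_bounds hε.le hε' hκ hρ1 hρM huρ hsplit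
  refine ⟨cosCoeff 1 u, fun h0 => hu.nontrivial ?_, (abs_cosCoeff_le 1 u).trans huρ, h1, h2⟩
  rw [h0, abs_zero, mul_zero] at h1
  exact norm_le_zero_iff.mp h1

theorem lemma2p2 (b s : ℝ) (hbs : 0 < 27 * s - 38 * b ^ 2) (hb : b ≠ 0) :
    ∃ ρ₀ : ℝ, 0 < ρ₀ ∧ ∀ ρ ∈ Ioc 0 ρ₀, ∀ ε₀ : ℝ, 0 < ε₀ →
      ∃ εbar ∈ Ioc 0 ε₀, ∀ ε ∈ Ioc 0 εbar, ∀ ω ∈ Ioo (-(1 / 2) : ℝ) (1 / 2),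
        (∃ u : C(Torus, ℝ), IsRoll b s ε ω u ∧ ∀ x, |u x| ≤ ρ) ∧
        ∀ u : C(Torus, ℝ), IsRoll b s ε ω u → (∀ x, |u x| ≤ ρ) →
          ∃ (lamM : ℝ) (σbar : ℝ × ℝ),
            IsUnstableEigenvalue (blochOperator b s ε ω u σbar) lamM ∧
            (∀ (σ : ℝ × ℝ) (μ : ℝ),
              IsUnstableEigenvalue (blochOperator b s ε ω u σ) μ → μ ≤ lamM) ∧
            ∃ (N : Set (ℝ × ℝ)) (lam : ℝ × ℝ → ℝ),
              IsOpen N ∧ σbar ∈ N ∧ AnalyticOnNhd ℝ lam N ∧ lam σbar = lamM ∧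
              ∀ σ ∈ N, IsUnstableEigenvalue (blochOperator b s ε ω u σ) (lam σ) := by
  set Λ := rollBound * rollLipschitz b s with hΛ
  have hΛ0 : 0 ≤ Λ := mul_nonneg rollBound_nonneg (rollLipschitz_nonneg b s)
  -- `D` collects `2|b| · 16Λ` from the profile error and `3|s| · 16` from `‖u‖² ≤ 16a²`. `E` is
  -- chosen so that `E |a|` is the smallness quantity required for the gap, whence `ρ₀` depends only
  -- on `b` and `s`.
  set D := 32 * |b| * Λ + 48 * |s| with hD
  have hD0 : 0 ≤ D := by positivity
  set E := (2 * (D / (4 * b ^ 2)) + 128) * (2 * |b|) with hE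
  have hE0 : 0 ≤ E := by positivity
  refine ⟨min 1 (min (1 / (2 * (Λ + 1))) (1 / (E + 1))),
    lt_min one_pos (lt_min (by positivity) (by positivity)), ?_⟩
  rintro ρ ⟨hρ, hρρ⟩ ε₀ hε₀
  have hρ1 : ρ ≤ 1 := hρρ.trans (min_le_left _ _)
  have hρM : Λ * ρ ≤ 1 / 2 := by
    have h1 : ρ ≤ 1 / (2 * (Λ + 1)) := hρρ.trans ((min_le_right _ _).trans (min_le_left _ _))
    rw [le_div_iff₀ (by positivity)] at h1
    nlinarith
  have hρE : E * ρ < 1 := by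
    have h1 : ρ ≤ 1 / (E + 1) := hρρ.trans ((min_le_right _ _).trans (min_le_right _ _))
    rw [le_div_iff₀ (by positivity)] at h1
    nlinarith
  obtain ⟨ε₁, hε₁, hε₁4, hroll⟩ := exists_roll hbs hρ hρ1 hρM
  refine ⟨min ε₀ ε₁, ⟨lt_min hε₀ hε₁, min_le_left _ _⟩, ?_⟩
  rintro ε ⟨hε, hεε⟩ ω hω
  have hεε₁ : ε ≤ ε₁ := hεε.trans (min_le_right _ _)
  refine ⟨hroll ε ⟨hε, hεε₁⟩ ω hω, fun u hu huρ => ?_⟩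
  have hε4 : ε ≤ 1 / 4 := hεε₁.trans hε₁4
  have huρ' : ‖u‖ ≤ ρ := (ContinuousMap.norm_le _ hρ.le).mpr huρ
  obtain ⟨a, ha, haρ, hu4, hw⟩ := hu.bounds hε hε4
    (abs_le.mpr ⟨by linarith [hω.1], hω.2.le⟩) hρ1 hρM huρ'
  have hεω : -(1 / 4) ≤ 2 * ε * ω ∧ 2 * ε * ω ≤ 1 / 4 := by
    constructor <;> nlinarith [hω.1, hω.2]
  refine exists_maximal_unstable_eigenvalue (D := D) hb ha (by linarith [hεω.1])
    (by linarith [hεω.2]) hD0 (fun x => ?_) ?_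
  · have e : ((2 * b * u x - 3 * s * u x ^ 2 : ℝ) : ℂ)
        - (2 * a * b : ℝ) * (fourier 1 x + fourier (-1) x)
        = ((2 * b * ((u - (2 * a) • cosFun 1) x) - 3 * s * u x ^ 2 : ℝ) : ℂ) := by
      have h1 : (fourier 1 x + fourier (-1) x : ℂ) = 2 * (cosFun 1 x : ℂ) := by
        rw [ofReal_cosFun]; ring
      rw [h1, ContinuousMap.sub_apply, ContinuousMap.smul_apply, smul_eq_mul]
      push_cast
      ring
    rw [e, Complex.norm_real, Real.norm_eq_abs]
    have h2 : |(u - (2 * a) • cosFun 1) x| ≤ 16 * Λ * a ^ 2 :=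
      (ContinuousMap.norm_coe_le_norm _ x).trans hw
    have h3 : u x ^ 2 ≤ 16 * a ^ 2 := by
      have h4 : |u x| ≤ 4 * |a| := (ContinuousMap.norm_coe_le_norm u x).trans hu4
      rw [← sq_abs (u x), ← sq_abs a]
      nlinarith [abs_nonneg (u x)]
    refine (abs_sub _ _).trans ?_
    rw [abs_mul, abs_mul, abs_mul, abs_mul, abs_two, abs_of_nonneg (sq_nonneg (u x)),
      abs_of_pos (by norm_num : (0 : ℝ) < 3)]
    calc 2 * |b| * |(u - (2 * a) • cosFun 1) x| + 3 * |s| * u x ^ 2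
        ≤ 2 * |b| * (16 * Λ * a ^ 2) + 3 * |s| * (16 * a ^ 2) := by gcongr
      _ = D * a ^ 2 := by rw [hD]; ring
  · have h1 : (2 * (D / (4 * b ^ 2)) + 128) * |2 * a * b| = E * |a| := by
      rw [hE, abs_mul, abs_mul, abs_two]; ring
    rw [h1]
    exact (mul_le_mul_of_nonneg_left haρ hE0).trans_lt hρE
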